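/- For $g\in\{3,4,5\}$ let $\mathcal T_g$ be the set of pairs $(a,b)$ of positive integers with $a\le b$ and $\gcd(a,b)=g$ that are the side lengths of a lattice equable parallelogram, that is, of a (nondegenerate) parallelogram with vertices in $\mathbb Z^2$ whose perimeter equals its area. Put $\Delta=a^2b^2-4(a+b)^2$ and define $$\varphi_{1},\varphi_2:(a,b)\mapsto\Bigl(a,\tfrac{a^2b\pm a\sqrt{\Delta}}2-2a-b\Bigr),\qquad \psi_{1},\psi_2:(a,b)\mapsto\Bigl(\tfrac{ab^2\pm b\sqrt{\Delta}}2-2b-a,\;b\Bigr),$$ with the sign $+$ for the index $1$ and $-$ for the index $2$; after applying one of these maps the two entries of the image are interchanged if necessary, so that the first is at most the second. Join two distinct elements of $\mathcal T_g$ by an edge if one of the four maps sends one of them to the other. Let $(f,s)=(1,3),(2,2),(5,1)$ and $\rho_g=(3,6),(4,4),(5,5)$ for $g=3,4,5$ respectively. Let $S$ be the set of positive integer solutions $(m,n,q)$ of the Markov–Rosenberger equation $m^2+n^2+fq^2=fs\,mnq$, with the maps $$\phi_1(m,n,q)=(fsnq-m,n,q),\quad \phi_2(m,n,q)=(m,fsmq-n,q),\quad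 \phi_3(m,n,q)=(m,n,smn-q).$$ Make $S$ a graph by joining two distinct solutions whenever some $\phi_i$ sends one to the other, and let $\tau(m,n,q)=(n,m,q)$. Then for each $g=3,4,5$: 1. $\mathcal T_g$ is infinite, and the graph on it is a tree. The four maps send $\mathcal T_g$ into itself, and two elements of $\mathcal T_g$ are adjacent if and only if one of the four maps sends the first to the second. 2. $\phi_1,\phi_2,\phi_3$ map $S$ into itself. For $g=3,4$ the graph $S$ is a tree. For $g=5$ it is a forest consisting of exactly two trees, which are interchanged by $\tau$. In all three cases the quotient graph $S/\tau$ is a tree. 3. The tree $\mathcal T_g$ is obtained from $S/\tau$ by contracting the edges given by $\phi_3$: the map sending $(m,n,q)$ to the pair with entries $fsq$ and $fs(smn-q)$, in increasing order, induces a graph isomorphism from the contracted graph onto $\mathcal T_g$. 4. The root $\rho_g$ belongs to $\mathcal T_g$ and is the unique element of $\mathcal T_g$ for which $a+b$ is minimal. Every vertex of $\mathcal T_g$ other than the root has degree $4$. The roots $(3,6)$ and $(5,5)$ have degree $2$, and the root $(4,4)$ has degree $1$. -/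

import Mathlib

noncomputable section

namespace LEP

/-! ## Lattice equable parallelograms and their side pairs -/

/-- A parallelogram with vertices in `ℤ²`: its vertices, in cyclic order, are
`base`, `base + u`, `base + u + v`, `base + v`, and it is nondegenerate. -/
structure LatticeParallelogram where
  base : ℤ × ℤ
  u : ℤ × ℤ
  v : ℤ × ℤ
  nondeg : u.1 * v.2 - u.2 * v.1 ≠ 0

/-- Euclidean length of an integer vector. -/
def length (w : ℤ × ℤ) : ℝ := √((w.1 : ℝ) ^ 2 + (w.2 : ℝ) ^ 2)

/-- Area of a lattice parallelogram. -/
def LatticeParallelogram.area (P : LatticeParallelogram) : ℝ :=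
  |(P.u.1 : ℝ) * P.v.2 - P.u.2 * P.v.1|

/-- Perimeter of a lattice parallelogram. -/
def LatticeParallelogram.perimeter (P : LatticeParallelogram) : ℝ :=
  2 * (length P.u + length P.v)

/-- A lattice parallelogram is equable if its perimeter equals its area. -/
def LatticeParallelogram.IsEquable (P : LatticeParallelogram) : Prop :=
  P.perimeter = P.area

/-- The set `T_g`: pairs `(a, b)` of positive integers with `a ≤ b` and `gcd (a, b) = g` which are
the side lengths of a lattice equable parallelogram. -/
def sidePairs (g : ℕ) : Set (ℤ × ℤ) :=
  {p | 0 < p.1 ∧ p.1 ≤ p.2 ∧ Int.gcd p.1 p.2 = g ∧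
    ∃ P : LatticeParallelogram, P.IsEquable ∧ length P.u = p.1 ∧ length P.v = p.2}

/-! ## The four maps and the graph on `T_g` -/

/-- `√(a² b² - 4 (a + b)²)`. -/
def disc (a b : ℝ) : ℝ := √(a ^ 2 * b ^ 2 - 4 * (a + b) ^ 2)

def varphi₁ (p : ℝ × ℝ) : ℝ × ℝ :=
  (p.1, (p.1 ^ 2 * p.2 + p.1 * disc p.1 p.2) / 2 - 2 * p.1 - p.2)

def varphi₂ (p : ℝ × ℝ) : ℝ × ℝ :=
  (p.1, (p.1 ^ 2 * p.2 - p.1 * disc p.1 p.2) / 2 - 2 * p.1 - p.2)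

def psi₁ (p : ℝ × ℝ) : ℝ × ℝ :=
  ((p.1 * p.2 ^ 2 + p.2 * disc p.1 p.2) / 2 - 2 * p.2 - p.1, p.2)

def psi₂ (p : ℝ × ℝ) : ℝ × ℝ :=
  ((p.1 * p.2 ^ 2 - p.2 * disc p.1 p.2) / 2 - 2 * p.2 - p.1, p.2)

/-- The four maps. -/
def sideMaps : Set (ℝ × ℝ → ℝ × ℝ) := {varphi₁, varphi₂, psi₁, psi₂}

/-- Reverse a pair if necessary so that the first entry is at most the second. -/
def sortPair {α : Type*} [LinearOrder α] (p : α × α) : α × α := (min p.1 p.2, max p.1 p.2)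

/-- An integer pair regarded as a real pair. -/
def toReal (p : ℤ × ℤ) : ℝ × ℝ := ((p.1 : ℝ), (p.2 : ℝ))

/-- The graph on `T_g`: two distinct pairs are joined by an edge if one of the four maps,
followed by sorting, sends one of them to the other. -/
def sideGraph (g : ℕ) : SimpleGraph (sidePairs g) :=
  SimpleGraph.fromRel fun p p' => ∃ F ∈ sideMaps, sortPair (F (toReal p.1)) = toReal p'.1

/-! ## Positive solutions of `m² + n² + f q² = f s m n q` -/

/-- The positive integer solutions `(m, n, q)` of `m² + n² + f q² = f s m n q`. -/
def solutions (f s : ℤ) : Set (ℤ × ℤ × ℤ) :=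
  {x | 0 < x.1 ∧ 0 < x.2.1 ∧ 0 < x.2.2 ∧
    x.1 ^ 2 + x.2.1 ^ 2 + f * x.2.2 ^ 2 = f * s * x.1 * x.2.1 * x.2.2}

def phi₁ (f s : ℤ) (x : ℤ × ℤ × ℤ) : ℤ × ℤ × ℤ := (f * s * x.2.1 * x.2.2 - x.1, x.2.1, x.2.2)

def phi₂ (f s : ℤ) (x : ℤ × ℤ × ℤ) : ℤ × ℤ × ℤ := (x.1, f * s * x.1 * x.2.2 - x.2.1, x.2.2)

def phi₃ (s : ℤ) (x : ℤ × ℤ × ℤ) : ℤ × ℤ × ℤ := (x.1, x.2.1, s * x.1 * x.2.1 - x.2.2)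

/-- The graph on the set of solutions: two distinct solutions are joined by an edge if one of
`φ₁, φ₂, φ₃` sends one of them to the other. -/
def solutionGraph (f s : ℤ) : SimpleGraph (solutions f s) :=
  SimpleGraph.fromRel fun x y =>
    y.1 = phi₁ f s x.1 ∨ y.1 = phi₂ f s x.1 ∨ y.1 = phi₃ s x.1

/-- The swap `(m, n, q) ↦ (n, m, q)`. -/
def swap {f s : ℤ} (x : solutions f s) : solutions f s :=
  ⟨(x.1.2.1, x.1.1, x.1.2.2), by
    obtain ⟨⟨m, n, q⟩, hm, hn, hq, h⟩ := x
    exact ⟨hn, hm, hq, by simp only at h ⊢; linarith⟩⟩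

/-- The graph obtained from `G` by identifying vertices related by `r`
(and dropping the loops which this creates). -/
def quotGraph {V : Type*} (G : SimpleGraph V) (r : V → V → Prop) : SimpleGraph (Quot r) where
  Adj A B := A ≠ B ∧ ∃ x y, Quot.mk r x = A ∧ Quot.mk r y = B ∧ G.Adj x y
  symm := ⟨fun _ _ h => ⟨h.1.symm, by
    obtain ⟨x, y, hx, hy, hxy⟩ := h.2
    exact ⟨y, x, hy, hx, hxy.symm⟩⟩⟩
  loopless := ⟨fun _ h => h.1 rfl⟩

/-- The relation identifying a solution with its swap. -/
def swapRel (f s : ℤ) (x y : solutions f s) : Prop := y = swap x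

/-- The quotient of the solution graph by the swap. -/
def swapQuotient (f s : ℤ) : SimpleGraph (Quot (swapRel f s)) :=
  quotGraph (solutionGraph f s) (swapRel f s)

/-- Two classes modulo the swap are related if `φ₃` sends a member of the first to a member of
the second. -/
def phi₃Rel (f s : ℤ) (A B : Quot (swapRel f s)) : Prop :=
  ∃ x y : solutions f s, Quot.mk _ x = A ∧ Quot.mk _ y = B ∧ y.1 = phi₃ s x.1

/-- The graph obtained from `swapQuotient f s` by contracting the edges given by `φ₃`. -/
def contractedGraph (f s : ℤ) : SimpleGraph (Quot (phi₃Rel f s)) :=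
  quotGraph (swapQuotient f s) (phi₃Rel f s)

/-- The pair of sides `(f s q, f s (s m n - q))`, sorted, attached to `(m, n, q)`. -/
def sidesOf (f s : ℤ) (x : ℤ × ℤ × ℤ) : ℤ × ℤ :=
  sortPair (f * s * x.2.2, f * s * (s * x.1 * x.2.1 - x.2.2))

end LEP

end

/-!
Fix a side `a`. Cleared of its square root, the formula for the new value `b'` of the other side `b`
is a quadratic equation, symmetric in `b` and `b'`; hence adjacency in `T_g` is symmetric. The sum
`a + b` differs between neighbours, at most one neighbour of a given pair has a smaller sum, and
only the root has none: a graph with such a height function is a rooted tree.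

The same criterion applies to the solutions, with height `m + n + q`. Since
`m (f s n q - m) = n² + f q²`, the map `φ₁` lowers the height exactly if `m²` exceeds `n² + f q²`,
and similarly for `φ₂` and `φ₃`; at most one of these three inequalities can hold. A solution
with none of them has `m² + n² + f q² ≤ 10`, because `f s² ≥ 5`, which leaves `(1, r, 1)` and
`(r, 1, 1)` with `r = 1`, or `r = 2` if `g = 5`.

Finally `a = f s q` and `b = f s (s m n - q)` turn the exchange of `b` into `φ₁` and `φ₂`, while
`φ₃` exchanges the roles of `a` and `b`. Two solutions have the same sides only if they agree up to
`φ₃` and the swap, and sides are found from the roots upwards, so `T_g` is the contracted quotient.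
-/

namespace LEP

/-! ## Rooted forests -/

section RootedForest

variable {V W : Type*} {G : SimpleGraph V} {h : V → ℕ} {r x y : V}

/-- A rooted forest presented by a height on its vertices instead of by parent pointers: adjacent
vertices have different heights, and every vertex has at most one lower neighbour, its parent. -/
structure IsRootedForest (G : SimpleGraph V) (h : V → ℕ) : Prop where
  height_ne : ∀ ⦃x y⦄, G.Adj x y → h x ≠ h y
  lower_unique : ∀ ⦃x y z⦄, G.Adj x y → G.Adj x z → h y < h x → h z < h x → y = z

/-- A root: a vertex without lower neighbours. -/
def IsRoot (G : SimpleGraph V) (h : V → ℕ) (r : V) : Prop := ∀ y, G.Adj r y → h r ≤ h y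

theorem descent_induction {P : V → Prop} (root : ∀ r, IsRoot G h r → P r)
    (step : ∀ x y, G.Adj x y → h y < h x → P y → P x) (x : V) : P x := by
  induction hx : h x using Nat.strong_induction_on generalizing x with
  | _ n ih =>
    subst hx
    by_cases hr : IsRoot G h x
    · exact root x hr
    · obtain ⟨y, hxy, hlt⟩ : ∃ y, G.Adj x y ∧ h y < h x := by simpa [IsRoot] using hr
      exact step x y hxy hlt (ih _ hlt y rfl)

theorem exists_isRoot_reachable (G : SimpleGraph V) (h : V → ℕ) (x : V) :
    ∃ r, IsRoot G h r ∧ G.Reachable x r :=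
  descent_induction (P := fun x => ∃ r, IsRoot G h r ∧ G.Reachable x r)
    (fun r hr => ⟨r, hr, .refl r⟩)
    (fun _ _ hxy _ ⟨r, hr, hyr⟩ => ⟨r, hr, hxy.reachable.trans hyr⟩) x

theorem height_lt_of_unique_root (unique : ∀ x, IsRoot G h x → x = r) (hx : x ≠ r) :
    h r < h x :=
  descent_induction (P := fun x => x ≠ r → h r < h x)
    (fun x hroot hne => absurd (unique x hroot) hne)
    (fun _ y _ hlt ih _ => (eq_or_ne y r).elim (fun he => he ▸ hlt) fun hne => (ih hne).trans hlt)
    x hx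

theorem IsRoot.map_iso (hx : IsRoot G h x) (σ : G ≃g G) (hh : ∀ v, h (σ v) = h v) :
    IsRoot G h (σ x) := fun y hxy => by
  have hle := hx (σ.symm y) (σ.map_rel_iff.1 (by rwa [σ.apply_symm_apply]))
  rwa [← hh x, ← hh (σ.symm y), σ.apply_symm_apply] at hle

namespace IsRootedForest

theorem isAcyclic (hG : IsRootedForest G h) : G.IsAcyclic := by
  classical
  intro v c hc
  obtain ⟨u, hu, hmax⟩ := c.support.toFinset.exists_max_image h ⟨v, by simp⟩
  rw [List.mem_toFinset] at hu
  set c' := c.rotate u hu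
  have hc' : c'.IsCycle := hc.rotate hu
  have lower {w : V} (hw : w ∈ c'.support) (huw : G.Adj u w) : h w < h u :=
    (hmax w (List.mem_toFinset.2 ((c.mem_support_rotate_iff u hu).1 hw))).lt_of_ne
      (hG.height_ne huw).symm
  have hsnd := c'.adj_snd hc'.not_nil
  have hpen := (c'.adj_penultimate hc'.not_nil).symm
  exact hc'.snd_ne_penultimate <| hG.lower_unique hsnd hpen
    (lower (c'.getVert_mem_support _) hsnd) (lower (c'.getVert_mem_support _) hpen)

theorem isTree (hG : IsRootedForest G h) (unique : ∀ x, IsRoot G h x → x = r) : G.IsTree where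
  connected :=
    { preconnected := fun x y => by
        obtain ⟨x', hx', hxx'⟩ := exists_isRoot_reachable G h x
        obtain ⟨y', hy', hyy'⟩ := exists_isRoot_reachable G h y
        rw [unique x' hx'] at hxx'
        rw [unique y' hy'] at hyy'
        exact hxx'.trans hyy'.symm
      nonempty := ⟨r⟩ }
  isAcyclic := hG.isAcyclic

/-- A step down from a vertex on an ascending path from a root can only retrace the path. -/
theorem ascending_of_reachable (hG : IsRootedForest G h) (hr : IsRoot G h r)
    (hrx : G.Reachable r x) : Relation.ReflTransGen (fun u v => G.Adj u v ∧ h u < h v) r x := by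
  rw [SimpleGraph.reachable_iff_reflTransGen] at hrx
  induction hrx with
  | refl => exact .refl
  | @tail y z _ hyz ih =>
    rcases (hG.height_ne hyz).lt_or_gt with hlt | hlt
    · exact ih.tail ⟨hyz, hlt⟩
    · rcases ih.cases_tail with rfl | ⟨w, hw, hwy, hlt'⟩
      · exact absurd hlt (hr z hyz).not_gt
      · rwa [hG.lower_unique hyz hwy.symm hlt hlt']

theorem isRoot_eq_of_reachable (hG : IsRootedForest G h) (hr : IsRoot G h r) (hx : IsRoot G h x)
    (hrx : G.Reachable r x) : r = x := by
  rcases (hG.ascending_of_reachable hr hrx).cases_tail with heq | ⟨w, -, hwx, hlt⟩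
  · exact heq.symm
  · exact absurd hlt (hx w hwx.symm).not_gt

theorem reachable_iff_not_reachable_of_two_roots (hG : IsRootedForest G h) (σ : G ≃g G)
    (hσ : ∀ x, σ (σ x) = x) (hh : ∀ x, h (σ x) = h x) (hσr : σ r ≠ r)
    (hr : ∀ x, IsRoot G h x → x = r ∨ x = σ r) (x y : V) :
    G.Reachable x y ↔ ¬ G.Reachable x (σ y) := by
  have hr₁ : IsRoot G h r := by
    obtain ⟨r', hr', -⟩ := exists_isRoot_reachable G h r
    rcases hr r' hr' with rfl | rfl
    exacts [hr', hσ r ▸ hr'.map_iso σ hh]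
  have hr₂ := hr₁.map_iso σ hh
  have exclusive (z : V) : ¬ (G.Reachable z r ∧ G.Reachable z (σ r)) := fun hz =>
    hσr (hG.isRoot_eq_of_reachable hr₁ hr₂ (hz.1.symm.trans hz.2)).symm
  have cover (z : V) : G.Reachable z r ∨ G.Reachable z (σ r) := by
    obtain ⟨r', hr', hz⟩ := exists_isRoot_reachable G h z
    rcases hr r' hr' with rfl | rfl
    exacts [.inl hz, .inr hz]
  have map_σ {u v : V} (huv : G.Reachable u v) : G.Reachable (σ u) (σ v) := huv.map σ.toHom
  have not_swap (z : V) : ¬ G.Reachable z (σ z) := fun hz => by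
    rcases cover z with hzr | hzr
    · exact exclusive z ⟨hzr, hz.trans (map_σ hzr)⟩
    · exact exclusive z ⟨hz.trans (by simpa [hσ] using map_σ hzr), hzr⟩
  refine ⟨fun hxy hxσ => not_swap y (hxy.symm.trans hxσ), fun hxσ => ?_⟩
  rcases cover x with hx | hx <;> rcases cover y with hy | hy
  · exact hx.trans hy.symm
  · exact absurd (hx.trans (by simpa [hσ] using (map_σ hy).symm)) hxσ
  · exact absurd (hx.trans (map_σ hy).symm) hxσ
  · exact hx.trans hy.symm

theorem map (π : V → W) {k : W → ℕ} (hG : IsRootedForest G (k ∘ π))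
    (hπ : ∀ x y, π x = π y → ∃ σ : G ≃g G, σ x = y ∧ ∀ v, π (σ v) = π v) :
    IsRootedForest (G.map π) k where
  height_ne := by
    rintro _ _ ⟨-, x, y, hxy, rfl, rfl⟩
    exact hG.height_ne hxy
  lower_unique := by
    rintro _ _ _ ⟨-, x, y, hxy, rfl, rfl⟩ ⟨-, x', z, hxz, hx', rfl⟩ hlty hltz
    obtain ⟨σ, rfl, hσ⟩ := hπ x' x hx'
    rw [← hσ z] at hltz ⊢
    exact congrArg π (hG.lower_unique hxy (σ.map_rel_iff.2 hxz) hlty hltz)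

theorem isRoot_of_map {π : V → W} {k : W → ℕ} (hG : IsRootedForest G (k ∘ π))
    (hx : IsRoot (G.map π) k (π x)) : IsRoot G (k ∘ π) x := fun y hxy =>
  hx (π y) ⟨fun he => hG.height_ne hxy (congrArg k he), x, y, hxy, rfl, rfl⟩

end IsRootedForest

end RootedForest

/-! ## Gaussian integers of square norm and side pairs -/

theorem dvd_star_iff_star_dvd {R : Type*} [CommSemigroup R] [StarMul R] {u z : R} :
    u ∣ star z ↔ star u ∣ z := by
  constructor
  · rintro ⟨v, hv⟩
    exact ⟨star v, by rw [← star_mul', ← hv, star_star]⟩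
  · rintro ⟨v, rfl⟩
    exact ⟨star v, by rw [star_mul', star_star]⟩

section GaussianInt

variable {p : ℕ} {z : GaussianInt}

theorem irreducible_of_norm_eq_prime {u : GaussianInt} (hp : p.Prime) (hu : u.norm = p) :
    Irreducible u := by
  refine ⟨fun hunit => ?_, fun x y hxy => ?_⟩
  · rw [← Zsqrtd.norm_eq_one_iff, hu] at hunit
    exact hp.one_lt.ne' (by simpa using hunit)
  · have hmul : x.norm.natAbs * y.norm.natAbs = p := by
      rw [← Int.natAbs_mul, ← Zsqrtd.norm_mul, ← hxy, hu, Int.natAbs_natCast]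
    rcases Nat.prime_mul_iff.1 (hmul ▸ hp) with ⟨-, hy⟩ | ⟨-, hx⟩
    · exact .inr (Zsqrtd.norm_eq_one_iff.1 hy)
    · exact .inl (Zsqrtd.norm_eq_one_iff.1 hx)

theorem exists_norm_eq_prime_dvd (hp : p.Prime) (h4 : p % 4 ≠ 3) (hz : (p : ℤ) ∣ z.norm) :
    ∃ u : GaussianInt, u.norm = p ∧ u ∣ z := by
  have := Fact.mk hp
  obtain ⟨a, b, hab⟩ := Nat.Prime.sq_add_sq h4
  set u : GaussianInt := ⟨a, b⟩ with hu
  have hnorm : u.norm = p := by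
    rw [Zsqrtd.norm_def, ← hab, hu]
    push_cast
    ring
  have hdvd : u ∣ z * star z := by
    rw [← Zsqrtd.norm_eq_mul_conj]
    have hup : u ∣ ((p : ℤ) : GaussianInt) := ⟨star u, by rw [← hnorm, Zsqrtd.norm_eq_mul_conj]⟩
    exact hup.trans (map_dvd (Int.castRingHom GaussianInt) hz)
  rcases (irreducible_of_norm_eq_prime hp hnorm).prime.dvd_or_dvd hdvd with huz | huz
  · exact ⟨u, hnorm, huz⟩
  · exact ⟨star u, by rw [Zsqrtd.norm_conj, hnorm], dvd_star_iff_star_dvd.1 huz⟩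

theorem exists_norm_eq_prime_sq_dvd (hp : p.Prime) (hz : (p : ℤ) ^ 2 ∣ z.norm) :
    ∃ u : GaussianInt, u.norm = (p : ℤ) ^ 2 ∧ u ∣ z := by
  by_cases h4 : p % 4 = 3
  · have := Fact.mk hp
    refine ⟨p, by rw [Zsqrtd.norm_natCast, sq], ?_⟩
    have hdvd : (p : GaussianInt) ∣ z * star z := by
      rw [← Zsqrtd.norm_eq_mul_conj]
      simpa using
        map_dvd (Int.castRingHom GaussianInt) ((dvd_pow_self (p : ℤ) two_ne_zero).trans hz)
    rcases (GaussianInt.prime_of_nat_prime_of_mod_four_eq_three p h4).dvd_or_dvd hdvd with hpz | hpz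
    · exact hpz
    · simpa using dvd_star_iff_star_dvd.1 hpz
  · obtain ⟨u, hu, v, rfl⟩ := exists_norm_eq_prime_dvd hp h4 ((dvd_pow_self _ two_ne_zero).trans hz)
    rw [Zsqrtd.norm_mul, hu, sq] at hz
    obtain ⟨u', hu', huv⟩ := exists_norm_eq_prime_dvd hp h4
      (Int.dvd_of_mul_dvd_mul_left (by exact_mod_cast hp.ne_zero) hz)
    exact ⟨u * u', by rw [Zsqrtd.norm_mul, hu, hu', sq], mul_dvd_mul_left u huv⟩

theorem exists_norm_eq_sq_dvd (a : ℕ) (hz : (a : ℤ) ^ 2 ∣ z.norm) :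
    ∃ u : GaussianInt, u.norm = (a : ℤ) ^ 2 ∧ u ∣ z := by
  induction a using induction_on_primes generalizing z with
  | zero =>
    have hz0 : z = 0 := (Zsqrtd.norm_eq_zero_iff (by norm_num) z).1 (by simpa using hz)
    exact ⟨0, by simp, by rw [hz0]⟩
  | one => exact ⟨1, by simp, one_dvd z⟩
  | prime_mul p a hp ih =>
    rw [Nat.cast_mul, mul_pow] at hz ⊢
    obtain ⟨u, hu, v, rfl⟩ := exists_norm_eq_prime_sq_dvd hp (dvd_of_mul_right_dvd hz)
    rw [Zsqrtd.norm_mul, hu] at hz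
    obtain ⟨u', hu', huv⟩ := ih (Int.dvd_of_mul_dvd_mul_left
      (pow_ne_zero 2 (by exact_mod_cast hp.ne_zero)) hz)
    exact ⟨u * u', by rw [Zsqrtd.norm_mul, hu, hu'], mul_dvd_mul_left u huv⟩

end GaussianInt

theorem length_eq_intCast_iff (w : ℤ × ℤ) {a : ℤ} (ha : 0 < a) :
    length w = a ↔ w.1 ^ 2 + w.2 ^ 2 = a ^ 2 := by
  have ha' : (0 : ℝ) ≤ a := by exact_mod_cast ha.le
  rw [length, Real.sqrt_eq_iff_eq_sq (by positivity) ha']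
  norm_cast

theorem LatticeParallelogram.IsEquable.isSquare {P : LatticeParallelogram} (hP : P.IsEquable)
    {a b : ℤ} (ha : 0 < a) (hb : 0 < b) (hu : length P.u = a) (hv : length P.v = b) :
    IsSquare (a ^ 2 * b ^ 2 - 4 * (a + b) ^ 2) := by
  have hdet : 4 * (a + b) ^ 2 = (P.u.1 * P.v.2 - P.u.2 * P.v.1) ^ 2 := by
    rw [IsEquable, perimeter, area, hu, hv] at hP
    have hsq : (4 : ℝ) * (a + b) ^ 2 = (P.u.1 * P.v.2 - P.u.2 * P.v.1) ^ 2 := by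
      rw [← sq_abs (_ - _), ← hP]
      ring
    exact_mod_cast hsq
  rw [length_eq_intCast_iff _ ha] at hu
  rw [length_eq_intCast_iff _ hb] at hv
  refine ⟨P.u.1 * P.v.1 + P.u.2 * P.v.2, ?_⟩
  rw [hdet, ← hu, ← hv]
  ring

/-- Factor `h + 2 (a + b) i`, whose norm is `a² b²`, as `z w` with `z` of norm `a²`; then the sides
are the conjugate of `z` and `w`. -/
theorem exists_isEquable_of_isSquare {a b : ℤ} (ha : 0 < a) (hb : 0 < b)
    (hab : IsSquare (a ^ 2 * b ^ 2 - 4 * (a + b) ^ 2)) :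
    ∃ P : LatticeParallelogram, P.IsEquable ∧ length P.u = a ∧ length P.v = b := by
  obtain ⟨h, hh⟩ := hab
  lift a to ℕ using ha.le
  have hnorm : (⟨h, 2 * (a + b)⟩ : GaussianInt).norm = (a : ℤ) ^ 2 * b ^ 2 := by
    rw [Zsqrtd.norm_def]
    linear_combination -hh
  obtain ⟨z, hz, w, hzw⟩ := exists_norm_eq_sq_dvd a ⟨_, hnorm⟩
  have hw : w.norm = b ^ 2 := by
    rw [hzw, Zsqrtd.norm_mul, hz] at hnorm
    exact mul_left_cancel₀ (pow_ne_zero 2 ha.ne') hnorm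
  have hdet : z.re * w.im - -z.im * w.re = 2 * (a + b) := by
    have him := congrArg Zsqrtd.im hzw
    rw [Zsqrtd.im_mul] at him
    simp only at him
    linarith
  rw [Zsqrtd.norm_def] at hz hw
  have hu : length (z.re, -z.im) = (a : ℤ) :=
    (length_eq_intCast_iff _ ha).2 (by linear_combination hz)
  have hv : length (w.re, w.im) = b := (length_eq_intCast_iff _ hb).2 (by linear_combination hw)
  refine ⟨⟨0, (z.re, -z.im), (w.re, w.im), by simp only; linarith⟩, ?_, hu, hv⟩
  rw [LatticeParallelogram.IsEquable, LatticeParallelogram.perimeter, LatticeParallelogram.area,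
    hu, hv]
  have hdet' : (z.re : ℝ) * w.im - ((-z.im : ℤ) : ℝ) * w.re = 2 * ((a : ℤ) + b) := by
    exact_mod_cast hdet
  rw [hdet', abs_of_pos]
  exact_mod_cast (by linarith : 0 < 2 * ((a : ℤ) + b))

section SortPair

variable {α : Type*} [LinearOrder α] {a b c d : α}

theorem sortPair_mk_comm (a b : α) : sortPair (a, b) = sortPair (b, a) :=
  Prod.ext (min_comm a b) (max_comm a b)

theorem sortPair_of_le (h : a ≤ b) : sortPair (a, b) = (a, b) :=
  Prod.ext (min_eq_left h) (max_eq_right h)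

theorem sortPair_mk_eq_iff :
    sortPair (a, b) = sortPair (c, d) ↔ a = c ∧ b = d ∨ a = d ∧ b = c := by
  constructor
  · simp only [sortPair, Prod.mk.injEq]
    grind
  · rintro (⟨rfl, rfl⟩ | ⟨rfl, rfl⟩)
    exacts [rfl, sortPair_mk_comm a b]

end SortPair

theorem sum_sortPair (p : ℤ × ℤ) : (sortPair p).1 + (sortPair p).2 = p.1 + p.2 :=
  min_add_max p.1 p.2

theorem toReal_injective : Function.Injective toReal := fun p q h => by
  simpa only [toReal, Prod.mk.injEq, Int.cast_inj, ← Prod.ext_iff] using h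

theorem toReal_sortPair (p : ℤ × ℤ) : toReal (sortPair p) = sortPair (toReal p) :=
  Prod.ext Int.cast_min Int.cast_max

/-- Positive integers `a` and `b` with greatest common divisor `g` which are, in either order, the
side lengths of a lattice equable parallelogram, in arithmetic terms. -/
structure IsSidePair (g : ℕ) (a b : ℤ) : Prop where
  fst_pos : 0 < a
  snd_pos : 0 < b
  gcd_eq : Int.gcd a b = g
  isSquare : IsSquare (a ^ 2 * b ^ 2 - 4 * (a + b) ^ 2)

namespace IsSidePair

variable {g : ℕ} {a b : ℤ}

theorem symm (h : IsSidePair g a b) : IsSidePair g b a where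
  fst_pos := h.snd_pos
  snd_pos := h.fst_pos
  gcd_eq := Int.gcd_comm b a ▸ h.gcd_eq
  isSquare := by simpa only [mul_comm, add_comm] using h.isSquare

theorem two_lt (h : IsSidePair g a b) : 2 < a := by
  have ha := h.fst_pos
  have hb := h.snd_pos
  have hle : 2 * (a + b) ≤ a * b := by
    refine le_of_sq_le_sq ?_ (by positivity)
    linarith [h.isSquare.nonneg, mul_pow a b 2, mul_pow 2 (a + b) 2]
  nlinarith

theorem exists_add_eq_mul_eq (h : IsSidePair g a b) :
    ∃ k l : ℤ, l ≤ k ∧ k + l = a * b ∧ k * l = (a + b) ^ 2 := by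
  obtain ⟨d, hd⟩ := h.isSquare
  rw [← abs_mul_abs_self] at hd
  have heven : Even (a * b + |d|) := by
    have hsq : Even ((a * b) ^ 2 - |d| ^ 2) := ⟨2 * (a + b) ^ 2, by linear_combination hd⟩
    rw [Int.even_sub, Int.even_pow' two_ne_zero, Int.even_pow' two_ne_zero] at hsq
    exact Int.even_add.2 hsq
  obtain ⟨k, hk⟩ := heven
  refine ⟨k, a * b - k, by linarith [abs_nonneg d], by ring, ?_⟩
  rw [eq_sub_of_add_eq' hk] at hd
  linarith

end IsSidePair

theorem mem_sidePairs_iff {g : ℕ} {p : ℤ × ℤ} :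
    p ∈ sidePairs g ↔ p.1 ≤ p.2 ∧ IsSidePair g p.1 p.2 := by
  constructor
  · rintro ⟨ha, hab, hg, P, hP, hu, hv⟩
    have hb := ha.trans_le hab
    exact ⟨hab, ha, hb, hg, hP.isSquare ha hb hu hv⟩
  · rintro ⟨hab, ha, hb, hg, hsq⟩
    exact ⟨ha, hab, hg, exists_isEquable_of_isSquare ha hb hsq⟩

theorem sortPair_mem_sidePairs_iff {g : ℕ} {a b : ℤ} :
    sortPair (a, b) ∈ sidePairs g ↔ IsSidePair g a b := by
  rw [mem_sidePairs_iff]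
  rcases le_total a b with hab | hab
  · simp only [sortPair_of_le hab, hab, true_and]
  · simp only [sortPair_mk_comm a b, sortPair_of_le hab, hab, true_and]
    exact ⟨.symm, .symm⟩

/-! ## Exchanging a side -/

section Exchange

/-- The relation between the side `b` and the side `b'` which replaces it under `φ₁` or `φ₂` while
`a` is kept. Cleared of the square root, those maps say `t² - a² b t + a² (a + b)² = 0` for
`t = 2 a + b + b'`; the form chosen here displays the symmetry in `b` and `b'`. -/
def Exchange {R : Type*} [CommRing R] (a b b' : R) : Prop :=
  (2 * a + b + b') ^ 2 = a ^ 2 * (b * b' - a ^ 2)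

theorem Exchange.symm {R : Type*} [CommRing R] {a b b' : R} (h : Exchange a b b') :
    Exchange a b' b := by
  rw [Exchange] at h ⊢
  linear_combination h

theorem exchange_iff {R : Type*} [CommRing R] [NoZeroDivisors R] {a b b' k l : R}
    (hadd : k + l = a * b) (hmul : k * l = (a + b) ^ 2) :
    Exchange a b b' ↔ b' = a * k - 2 * a - b ∨ b' = a * l - 2 * a - b := by
  have hfactor : (2 * a + b + b') ^ 2 - a ^ 2 * (b * b' - a ^ 2) =
      (b' - (a * k - 2 * a - b)) * (b' - (a * l - 2 * a - b)) := by
    linear_combination a * (2 * a + b + b') * hadd - a ^ 2 * hmul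
  rw [Exchange, ← sub_eq_zero, hfactor, mul_eq_zero, sub_eq_zero, sub_eq_zero]

variable {g : ℕ} {a b b' b₁ b₂ : ℤ}

theorem Exchange.sq_le_mul (h : Exchange a b b') (ha : a ≠ 0) : a ^ 2 ≤ b * b' := by
  have hnonneg : 0 ≤ a ^ 2 * (b * b' - a ^ 2) := h ▸ sq_nonneg _
  linarith [nonneg_of_mul_nonneg_right hnonneg (by positivity)]

theorem Exchange.pos (h : Exchange a b b') (ha : a ≠ 0) (hb : 0 < b) : 0 < b' :=
  pos_of_mul_pos_right ((by positivity : 0 < a ^ 2).trans_le (h.sq_le_mul ha)) hb.le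

theorem Exchange.lt_of_lt (h : Exchange a b b') (ha : a ≠ 0) (hb : 0 < b) (hlt : b' < b) :
    a < b := by
  have := h.sq_le_mul ha
  nlinarith

theorem Exchange.eq_of_lt (ha : 2 ≤ a) (hb : 0 < b) (h₁ : Exchange a b b₁) (h₂ : Exchange a b b₂)
    (hlt₁ : b₁ < b) (hlt₂ : b₂ < b) : b₁ = b₂ := by
  have hb₁ := h₁.pos (by linarith) hb
  have hb₂ := h₂.pos (by linarith) hb
  rw [Exchange] at h₁ h₂
  by_contra hne
  have hadd : (2 * a + b + b₁) + (2 * a + b + b₂) = a ^ 2 * b :=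
    mul_left_cancel₀ (sub_ne_zero.2 hne) (by linear_combination h₁ - h₂)
  have hmul : (2 * a + b + b₁) * (2 * a + b + b₂) = a ^ 2 * (a + b) ^ 2 := by
    linear_combination (2 * a + b + b₁) * hadd - h₁
  have hlt : (2 * a + b + b₁) * (2 * a + b + b₂) < (2 * (a + b)) * (2 * (a + b)) := by
    gcongr <;> linarith
  nlinarith [hlt, pow_pos (by linarith : 0 < a + b) 2]

theorem IsSidePair.exchange (h : IsSidePair g a b) (hex : Exchange a b b') :
    IsSidePair g a b' := by
  have ha := h.fst_pos
  have hex' : (2 * a + b + b') ^ 2 = a ^ 2 * (b * b' - a ^ 2) := hex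
  obtain ⟨k, hk⟩ : a ∣ 2 * a + b + b' := (Int.pow_dvd_pow_iff two_ne_zero).1 ⟨_, hex'⟩
  have hk2 : k ^ 2 = b * b' - a ^ 2 := by
    rw [hk, mul_pow] at hex'
    exact mul_left_cancel₀ (by positivity) hex'
  refine ⟨ha, hex.pos ha.ne' h.snd_pos, ?_, 2 * k - a * b', ?_⟩
  · rw [← h.gcd_eq, eq_sub_of_add_eq' hk, show a * k - (2 * a + b) = -b + a * (k - 2) by ring,
      Int.gcd_add_mul_left_right, Int.gcd_neg]
  · linear_combination (-4) * hk2 - 4 * b' * hk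

end Exchange

section SideMaps

theorem varphi₁_swap (p : ℝ × ℝ) : varphi₁ p.swap = (psi₁ p).swap := by
  simp only [varphi₁, psi₁, disc, Prod.swap, Prod.mk.injEq, true_and]
  ring_nf

theorem varphi₂_swap (p : ℝ × ℝ) : varphi₂ p.swap = (psi₂ p).swap := by
  simp only [varphi₂, psi₂, disc, Prod.swap, Prod.mk.injEq, true_and]
  ring_nf

variable {a b k l : ℝ}

theorem disc_eq_sub (hle : l ≤ k) (hadd : k + l = a * b) (hmul : k * l = (a + b) ^ 2) :
    disc a b = k - l := by
  rw [disc, ← Real.sqrt_sq (sub_nonneg.2 hle)]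
  congr 1
  linear_combination 4 * hmul - (k + l + a * b) * hadd

theorem varphi₁_eq (hle : l ≤ k) (hadd : k + l = a * b) (hmul : k * l = (a + b) ^ 2) :
    varphi₁ (a, b) = (a, a * k - 2 * a - b) := by
  rw [varphi₁, disc_eq_sub hle hadd hmul]
  exact Prod.ext rfl (by linear_combination (-a / 2) * hadd)

theorem varphi₂_eq (hle : l ≤ k) (hadd : k + l = a * b) (hmul : k * l = (a + b) ^ 2) :
    varphi₂ (a, b) = (a, a * l - 2 * a - b) := by
  rw [varphi₂, disc_eq_sub hle hadd hmul]
  exact Prod.ext rfl (by linear_combination (-a / 2) * hadd)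

theorem psi₁_eq (hle : l ≤ k) (hadd : k + l = a * b) (hmul : k * l = (a + b) ^ 2) :
    psi₁ (a, b) = (b * k - 2 * b - a, b) := by
  apply Prod.swap_injective
  rw [← varphi₁_swap]
  exact varphi₁_eq hle (by rw [hadd, mul_comm]) (by rw [hmul, add_comm])

theorem psi₂_eq (hle : l ≤ k) (hadd : k + l = a * b) (hmul : k * l = (a + b) ^ 2) :
    psi₂ (a, b) = (b * l - 2 * b - a, b) := by
  apply Prod.swap_injective
  rw [← varphi₂_swap]
  exact varphi₂_eq hle (by rw [hadd, mul_comm]) (by rw [hmul, add_comm])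

/-- The images of `(a, b)` under `φ₁, φ₂, ψ₁, ψ₂`, before sorting, in terms of the roots
`k = (a b + √Δ) / 2` and `l = (a b - √Δ) / 2` of `X² - a b X + (a + b)²`. -/
def sideImages (a b k l : ℤ) : Set (ℤ × ℤ) :=
  {(a, a * k - 2 * a - b), (a, a * l - 2 * a - b), (b * k - 2 * b - a, b), (b * l - 2 * b - a, b)}

theorem image_sideMaps {a b k l : ℤ} (hle : l ≤ k) (hadd : k + l = a * b)
    (hmul : k * l = (a + b) ^ 2) :
    (fun F => F (toReal (a, b))) '' sideMaps = toReal '' sideImages a b k l := by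
  have hle' : (l : ℝ) ≤ k := by exact_mod_cast hle
  have hadd' : (k + l : ℝ) = a * b := by exact_mod_cast hadd
  have hmul' : (k * l : ℝ) = (a + b) ^ 2 := by exact_mod_cast hmul
  simp only [sideMaps, sideImages, Set.image_insert_eq, Set.image_singleton, toReal,
    varphi₁_eq hle' hadd' hmul', varphi₂_eq hle' hadd' hmul', psi₁_eq hle' hadd' hmul',
    psi₂_eq hle' hadd' hmul', Int.cast_sub, Int.cast_mul, Int.cast_ofNat]

end SideMaps

/-! ## The graph of side pairs -/

/-- The relation between two sorted pairs, one of which arises from the other by exchanging one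
side. -/
def SideStep (p p' : ℤ × ℤ) : Prop :=
  ∃ a b b', p = sortPair (a, b) ∧ p' = sortPair (a, b') ∧ Exchange a b b'

section SideStep

variable {g : ℕ} {a b k l : ℤ} {p p' : ℤ × ℤ}

theorem SideStep.symm (h : SideStep p p') : SideStep p' p := by
  obtain ⟨a, b, b', rfl, rfl, hex⟩ := h
  exact ⟨a, b', b, rfl, rfl, hex.symm⟩

theorem SideStep.mem_sidePairs (h : SideStep p p') (hp : p ∈ sidePairs g) : p' ∈ sidePairs g := by
  obtain ⟨a, b, b', rfl, rfl, hex⟩ := h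
  exact sortPair_mem_sidePairs_iff.2 ((sortPair_mem_sidePairs_iff.1 hp).exchange hex)

theorem sideStep_sortPair_iff : SideStep (sortPair (a, b)) p' ↔
    (∃ b', Exchange a b b' ∧ p' = sortPair (a, b')) ∨
      ∃ a', Exchange b a a' ∧ p' = sortPair (b, a') := by
  constructor
  · rintro ⟨c, d, d', hp, rfl, hex⟩
    rcases sortPair_mk_eq_iff.1 hp with ⟨rfl, rfl⟩ | ⟨rfl, rfl⟩
    exacts [.inl ⟨d', hex, rfl⟩, .inr ⟨d', hex, rfl⟩]
  · rintro (⟨b', hex, rfl⟩ | ⟨a', hex, rfl⟩)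
    · exact ⟨a, b, b', rfl, rfl, hex⟩
    · exact ⟨b, a, a', sortPair_mk_comm a b, rfl, hex⟩

theorem sideStep_mk_iff (hab : a ≤ b) : SideStep (a, b) p' ↔
    (∃ b', Exchange a b b' ∧ p' = sortPair (a, b')) ∨
      ∃ a', Exchange b a a' ∧ p' = sortPair (b, a') := by
  rw [← sideStep_sortPair_iff, sortPair_of_le hab]

theorem sideStep_iff_mem_sideImages (hab : a ≤ b) (hadd : k + l = a * b)
    (hmul : k * l = (a + b) ^ 2) :
    SideStep (a, b) p' ↔ p' ∈ sortPair '' sideImages a b k l := by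
  rw [sideStep_mk_iff hab]
  simp only [exchange_iff hadd hmul, exchange_iff (hadd.trans (mul_comm a b))
    (hmul.trans (congrArg (· ^ 2) (add_comm a b))), sideImages, Set.image_insert_eq,
    Set.image_singleton, Set.mem_insert_iff, Set.mem_singleton_iff, or_and_right, exists_or,
    exists_eq_left, sortPair_mk_comm _ b, or_assoc]

theorem exists_sideImages (hp : p ∈ sidePairs g) :
    ∃ S : Set (ℤ × ℤ), (fun F => F (toReal p)) '' sideMaps = toReal '' S ∧
      ∀ p', SideStep p p' ↔ p' ∈ sortPair '' S := by
  obtain ⟨hab, hp⟩ := mem_sidePairs_iff.1 hp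
  obtain ⟨k, l, hle, hadd, hmul⟩ := hp.exists_add_eq_mul_eq
  exact ⟨sideImages p.1 p.2 k l, image_sideMaps hle hadd hmul,
    fun _ => sideStep_iff_mem_sideImages hab hadd hmul⟩

theorem exists_sideStep_of_mem_sideMaps (hp : p ∈ sidePairs g) {F : ℝ × ℝ → ℝ × ℝ}
    (hF : F ∈ sideMaps) : ∃ p', SideStep p p' ∧ sortPair (F (toReal p)) = toReal p' := by
  obtain ⟨S, himage, hS⟩ := exists_sideImages hp
  obtain ⟨q, hq, hqF⟩ : F (toReal p) ∈ toReal '' S := himage ▸ ⟨F, hF, rfl⟩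
  exact ⟨sortPair q, (hS _).2 ⟨q, hq, rfl⟩, by rw [toReal_sortPair, hqF]⟩

theorem exists_mem_sideMaps_iff (hp : p ∈ sidePairs g) :
    (∃ F ∈ sideMaps, sortPair (F (toReal p)) = toReal p') ↔ SideStep p p' := by
  constructor
  · rintro ⟨F, hF, hFp⟩
    obtain ⟨p'', hstep, hFp''⟩ := exists_sideStep_of_mem_sideMaps hp hF
    rwa [← toReal_injective (hFp''.symm.trans hFp)]
  · intro hstep
    obtain ⟨S, himage, hS⟩ := exists_sideImages hp
    obtain ⟨q, hq, rfl⟩ := (hS p').1 hstep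
    obtain ⟨F, hF, hFp⟩ : toReal q ∈ (fun F => F (toReal p)) '' sideMaps := himage ▸ ⟨q, hq, rfl⟩
    exact ⟨F, hF, by rw [toReal_sortPair, ← hFp]⟩

end SideStep

/-- The pair `ρ` is the root of the graph of side pairs with greatest common divisor `g`. -/
def IsRootPair (g : ℕ) (ρ : ℤ × ℤ) : Prop :=
  (g = 3 ∧ ρ = (3, 6)) ∨ (g = 4 ∧ ρ = (4, 4)) ∨ (g = 5 ∧ ρ = (5, 5))

section RootPair

variable {g : ℕ} {ρ : ℤ × ℤ} {a b k l : ℤ}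

theorem IsRootPair.mem_sidePairs (hρ : IsRootPair g ρ) : ρ ∈ sidePairs g := by
  rw [mem_sidePairs_iff]
  rcases hρ with ⟨rfl, rfl⟩ | ⟨rfl, rfl⟩ | ⟨rfl, rfl⟩
  · exact ⟨by norm_num, by norm_num, by norm_num, by norm_num, 0, by norm_num⟩
  · exact ⟨by norm_num, by norm_num, by norm_num, by norm_num, 0, by norm_num⟩
  · exact ⟨by norm_num, by norm_num, by norm_num, by norm_num, 15, by norm_num⟩

/-- Divide by `g` and put `α = a / g`, `δ = (b - a) / g`: the hypothesis becomes
`δ (g² α² - 4) ≤ 8 α`. -/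
theorem IsRootPair.eq_of_sq_mul_sub_le (hρ : IsRootPair g ρ) (h : IsSidePair g a b) (hab : a ≤ b)
    (hle : a ^ 2 * (b - a) ≤ 4 * (a + b)) : (a, b) = ρ := by
  have hg : 3 ≤ g := by rcases hρ with ⟨rfl, -⟩ | ⟨rfl, -⟩ | ⟨rfl, -⟩ <;> norm_num
  obtain ⟨α, β, hco, hα, hβ⟩ := Int.exists_gcd_one (h.gcd_eq ▸ (by lia) : 0 < Int.gcd a b)
  rw [h.gcd_eq] at hα hβ
  subst hα hβ
  have hg' : (3 : ℤ) ≤ g := by exact_mod_cast hg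
  have hα : 0 < α := pos_of_mul_pos_left h.fst_pos (by positivity)
  have hαβ : α ≤ β := le_of_mul_le_mul_right hab (by lia)
  have hδ : (g : ℤ) ^ 2 * α ^ 2 * (β - α) ≤ 4 * (α + β) :=
    le_of_mul_le_mul_right (by linarith) (by lia : (0 : ℤ) < g)
  have hα1 : α = 1 := by
    rcases hαβ.eq_or_lt with rfl | hlt
    · rw [Int.gcd_self] at hco
      lia
    · have hg9 : (3 : ℤ) ^ 2 ≤ g ^ 2 := by gcongr
      by_contra hne
      have hα2 : 2 ≤ α := by lia
      have hα4 : 9 * (2 * α) ≤ (g : ℤ) ^ 2 * α ^ 2 := by nlinarith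
      nlinarith
  subst hα1
  rcases hρ with ⟨rfl, rfl⟩ | ⟨rfl, rfl⟩ | ⟨rfl, rfl⟩
  · have := h.isSquare.nonneg
    obtain rfl : β = 2 := by
      obtain rfl | rfl : β = 1 ∨ β = 2 := by norm_num at hδ; lia
      · norm_num at this
      · rfl
    norm_num
  · obtain rfl : β = 1 := by norm_num at hδ; lia
    norm_num
  · obtain rfl : β = 1 := by norm_num at hδ; lia
    norm_num

theorem IsRootPair.not_exchange_self (hρ : IsRootPair g ρ) (h : IsSidePair g a b) :
    ¬ Exchange a b b := by
  intro hex
  have ha := h.fst_pos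
  have hab : a ≤ b := by
    have := hex.sq_le_mul ha.ne'
    nlinarith [h.snd_pos]
  have hle : a ^ 2 * (b - a) ≤ 4 * (a + b) := by
    have : (a + b) * (a ^ 2 * (b - a) - 4 * (a + b)) = 0 := by
      rw [Exchange] at hex
      linear_combination -hex
    rcases mul_eq_zero.1 this with h0 | h0 <;> linarith [h.snd_pos]
  have := hρ.eq_of_sq_mul_sub_le h hab hle
  rcases hρ with ⟨-, rfl⟩ | ⟨-, rfl⟩ | ⟨-, rfl⟩ <;> obtain ⟨rfl, rfl⟩ := Prod.mk.inj this <;>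
    norm_num [Exchange] at hex

theorem IsSidePair.mul_lt_mul_of_lt (h : IsSidePair g a b) (hle : l ≤ k) (hadd : k + l = a * b)
    (hmul : k * l = (a + b) ^ 2) (hlt : 4 * (a + b) < a ^ 2 * (b - a)) :
    a * l < 2 * (a + b) ∧ 2 * (a + b) < a * k := by
  have hsum : 0 < a + b := add_pos h.fst_pos h.snd_pos
  have hle' : a * l ≤ a * k := mul_le_mul_of_nonneg_left hle h.fst_pos.le
  have hneg : (a * k - 2 * (a + b)) * (a * l - 2 * (a + b)) < 0 := by
    have : (a * k - 2 * (a + b)) * (a * l - 2 * (a + b)) =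
        (a + b) * (4 * (a + b) - a ^ 2 * (b - a)) := by
      linear_combination a ^ 2 * hmul - 2 * (a + b) * a * hadd
    rw [this]
    exact mul_neg_of_pos_of_neg hsum (by linarith)
  rcases mul_neg_iff.1 hneg with h' | h' <;> constructor <;> linarith

end RootPair

section SideGraph

variable {g : ℕ} {ρ : ℤ × ℤ}

theorem SideStep.exists_exchange_of_lt {p p' : ℤ × ℤ} (h : SideStep p p') (hp : p ∈ sidePairs g)
    (hlt : p'.1 + p'.2 < p.1 + p.2) :
    ∃ b', Exchange p.1 p.2 b' ∧ b' < p.2 ∧ p' = sortPair (p.1, b') := by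
  obtain ⟨a, b, b', rfl, rfl, hex⟩ := h
  have hab := sortPair_mem_sidePairs_iff.1 hp
  simp only [sum_sortPair, add_lt_add_iff_left] at hlt
  rw [sortPair_of_le (hex.lt_of_lt hab.fst_pos.ne' hab.snd_pos hlt).le]
  exact ⟨b', hex, hlt, rfl⟩

theorem SideStep.sum_ne {p p' : ℤ × ℤ} (hρ : IsRootPair g ρ) (h : SideStep p p')
    (hp : p ∈ sidePairs g) : p.1 + p.2 ≠ p'.1 + p'.2 := by
  obtain ⟨a, b, b', rfl, rfl, hex⟩ := h
  simp only [sum_sortPair, ne_eq, add_right_inj]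
  rintro rfl
  exact hρ.not_exchange_self (sortPair_mem_sidePairs_iff.1 hp) hex

theorem sideGraph_adj_iff (hρ : IsRootPair g ρ) {p p' : sidePairs g} :
    (sideGraph g).Adj p p' ↔ SideStep p.1 p'.1 := by
  rw [sideGraph, SimpleGraph.fromRel_adj, exists_mem_sideMaps_iff p.2, exists_mem_sideMaps_iff p'.2,
    or_iff_left_of_imp SideStep.symm, and_iff_right_iff_imp]
  rintro h rfl
  exact h.sum_ne hρ p.2 rfl

/-- The height of a side pair in the rooted tree of side pairs: the semiperimeter. -/
def sideHeight (p : sidePairs g) : ℕ := (p.1.1 + p.1.2).toNat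

theorem sideHeight_cast (p : sidePairs g) : (sideHeight p : ℤ) = p.1.1 + p.1.2 :=
  Int.toNat_of_nonneg (add_nonneg p.2.1.le (p.2.1.le.trans p.2.2.1))

theorem sideHeight_lt_iff {p p' : sidePairs g} :
    sideHeight p < sideHeight p' ↔ p.1.1 + p.1.2 < p'.1.1 + p'.1.2 := by
  rw [← sideHeight_cast, ← sideHeight_cast, Nat.cast_lt]

theorem isRootedForest_sideGraph (hρ : IsRootPair g ρ) :
    IsRootedForest (sideGraph g) sideHeight where
  height_ne p p' hadj := by
    rw [← Nat.cast_injective (R := ℤ) |>.ne_iff, sideHeight_cast, sideHeight_cast]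
    exact ((sideGraph_adj_iff hρ).1 hadj).sum_ne hρ p.2
  lower_unique p p₁ p₂ h₁ h₂ hlt₁ hlt₂ := by
    rw [sideGraph_adj_iff hρ] at h₁ h₂
    obtain ⟨b₁, hex₁, hb₁, hp₁⟩ := h₁.exists_exchange_of_lt p.2 (sideHeight_lt_iff.1 hlt₁)
    obtain ⟨b₂, hex₂, hb₂, hp₂⟩ := h₂.exists_exchange_of_lt p.2 (sideHeight_lt_iff.1 hlt₂)
    have hp := (mem_sidePairs_iff.1 p.2).2
    rw [Subtype.ext_iff, hp₁, hp₂, hex₁.eq_of_lt hp.two_lt.le hp.snd_pos hex₂ hb₁ hb₂]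

theorem eq_root_of_isRoot (hρ : IsRootPair g ρ) (p : sidePairs g)
    (hroot : IsRoot (sideGraph g) sideHeight p) : p = ⟨ρ, hρ.mem_sidePairs⟩ := by
  obtain ⟨⟨a, b⟩, hp⟩ := p
  obtain ⟨hab, h⟩ : a ≤ b ∧ IsSidePair g a b := mem_sidePairs_iff.1 hp
  by_contra hne
  obtain ⟨k, l, hle, hadd, hmul⟩ := h.exists_add_eq_mul_eq
  have hlt : 4 * (a + b) < a ^ 2 * (b - a) :=
    not_le.1 fun h' => hne (Subtype.ext (hρ.eq_of_sq_mul_sub_le h hab h'))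
  have hstep : SideStep (a, b) (sortPair (a, a * l - 2 * a - b)) :=
    (sideStep_mk_iff hab).2 (.inl ⟨_, (exchange_iff hadd hmul).2 (.inr rfl), rfl⟩)
  have hlower := hroot ⟨_, hstep.mem_sidePairs hp⟩ ((sideGraph_adj_iff hρ).2 hstep)
  rw [← not_lt, sideHeight_lt_iff, sum_sortPair] at hlower
  exact hlower (by linarith [(h.mul_lt_mul_of_lt hle hadd hmul hlt).1])

theorem sideGraph_isTree (hρ : IsRootPair g ρ) : (sideGraph g).IsTree :=
  (isRootedForest_sideGraph hρ).isTree (eq_root_of_isRoot hρ)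

theorem root_sum_lt (hρ : IsRootPair g ρ) {p : ℤ × ℤ} (hp : p ∈ sidePairs g) (hne : p ≠ ρ) :
    ρ.1 + ρ.2 < p.1 + p.2 :=
  sideHeight_lt_iff.1 (height_lt_of_unique_root (eq_root_of_isRoot hρ)
    (x := ⟨p, hp⟩) (fun h => hne (congrArg Subtype.val h)))

/-- Exchanging the smaller side yields ever larger pairs. -/
theorem infinite_sidePairs (h : (sidePairs g).Nonempty) : Infinite (sidePairs g) := by
  have := h.to_subtype
  by_contra hfin
  rw [not_infinite_iff_finite] at hfin
  obtain ⟨⟨⟨a, b⟩, hp⟩, hmax⟩ := Finite.exists_max (sideHeight (g := g))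
  obtain ⟨hab, h⟩ : a ≤ b ∧ IsSidePair g a b := mem_sidePairs_iff.1 hp
  obtain ⟨k, l, hle, hadd, hmul⟩ := h.exists_add_eq_mul_eq
  have hk0 : 0 ≤ k := by linarith [mul_pos h.fst_pos h.snd_pos]
  have hk : a + b ≤ k := le_of_sq_le_sq (by rw [← hmul, sq]; gcongr) hk0
  have hstep : SideStep (a, b) (sortPair (b, b * k - 2 * b - a)) :=
    (sideStep_mk_iff hab).2 (.inr ⟨_, (exchange_iff (hadd.trans (mul_comm a b))
      (hmul.trans (congrArg (· ^ 2) (add_comm a b)))).2 (.inl rfl), rfl⟩)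
  have hlt : a + b < b + (b * k - 2 * b - a) := by
    nlinarith [h.symm.two_lt, h.fst_pos, h.snd_pos]
  refine (hmax ⟨_, hstep.mem_sidePairs hp⟩).not_gt ?_
  rwa [sideHeight_lt_iff, sum_sortPair]

theorem neighborSet_sideGraph (hρ : IsRootPair g ρ) (p : sidePairs g) :
    Subtype.val '' (sideGraph g).neighborSet p = {p' | SideStep p.1 p'} := by
  ext p'
  constructor
  · rintro ⟨p', hadj, rfl⟩
    exact (sideGraph_adj_iff hρ).1 hadj
  · exact fun hstep => ⟨⟨p', hstep.mem_sidePairs p.2⟩, (sideGraph_adj_iff hρ).2 hstep, rfl⟩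

theorem encard_neighborSet_sideGraph (hρ : IsRootPair g ρ) {a b k l : ℤ}
    (hp : (a, b) ∈ sidePairs g) (hadd : k + l = a * b) (hmul : k * l = (a + b) ^ 2) :
    ((sideGraph g).neighborSet ⟨(a, b), hp⟩).encard = (sortPair '' sideImages a b k l).encard := by
  rw [← Subtype.val_injective.encard_image, neighborSet_sideGraph hρ]
  congr 1
  ext p'
  exact sideStep_iff_mem_sideImages (mem_sidePairs_iff.1 hp).1 hadd hmul

theorem encard_image_sortPair {α : Type*} [LinearOrder α] {a b x x' y y' : α} (hab : a ≠ b)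
    (hx : x ≠ x') (hy : y ≠ y') (hxb : x ≠ b) (hxb' : x' ≠ b) :
    (sortPair '' {(a, x), (a, x'), (y, b), (y', b)}).encard = 4 := by
  simp only [Set.image_insert_eq, Set.image_singleton]
  rw [Set.encard_insert_of_notMem, Set.encard_insert_of_notMem, Set.encard_pair]
  · norm_num
  all_goals
    simp only [Set.mem_insert_iff, Set.mem_singleton_iff, sortPair_mk_eq_iff, ne_eq]
    grind

theorem encard_neighborSet_of_ne_root (hρ : IsRootPair g ρ) (p : sidePairs g) (hne : p.1 ≠ ρ) :
    ((sideGraph g).neighborSet p).encard = 4 := by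
  obtain ⟨⟨a, b⟩, hp⟩ := p
  obtain ⟨hab, h⟩ : a ≤ b ∧ IsSidePair g a b := mem_sidePairs_iff.1 hp
  obtain ⟨k, l, hle, hadd, hmul⟩ := h.exists_add_eq_mul_eq
  have hlt : 4 * (a + b) < a ^ 2 * (b - a) :=
    not_le.1 fun h' => hne (hρ.eq_of_sq_mul_sub_le h hab h')
  have hab' : a ≠ b := by
    rintro rfl
    linarith [h.fst_pos, mul_eq_zero_of_right (a ^ 2) (sub_self a)]
  obtain ⟨hl, hk⟩ := h.mul_lt_mul_of_lt hle hadd hmul hlt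
  have hkl : k ≠ l := by
    rintro rfl
    exact hl.not_gt hk
  have hexb {b' : ℤ} (hex : Exchange a b b') : b' ≠ b := by
    rintro rfl
    exact hρ.not_exchange_self h hex
  rw [encard_neighborSet_sideGraph hρ hp hadd hmul]
  refine encard_image_sortPair hab' ?_ ?_ (hexb ((exchange_iff hadd hmul).2 (.inl rfl)))
    (hexb ((exchange_iff hadd hmul).2 (.inr rfl)))
  · simpa [h.fst_pos.ne'] using hkl
  · simpa [h.snd_pos.ne'] using hkl

theorem encard_neighborSet_three (h : ((3, 6) : ℤ × ℤ) ∈ sidePairs 3) :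
    ((sideGraph 3).neighborSet ⟨(3, 6), h⟩).encard = 2 := by
  rw [encard_neighborSet_sideGraph (.inl ⟨rfl, rfl⟩) h (k := 9) (l := 9) (by norm_num)
    (by norm_num)]
  have himage : sortPair '' sideImages 3 6 9 9 = {(3, 15), (6, 39)} := by
    norm_num [sideImages, Set.image_insert_eq, sortPair]
  rw [himage]
  exact Set.encard_pair (by norm_num)

theorem encard_neighborSet_four (h : ((4, 4) : ℤ × ℤ) ∈ sidePairs 4) :
    ((sideGraph 4).neighborSet ⟨(4, 4), h⟩).encard = 1 := by
  rw [encard_neighborSet_sideGraph (.inr (.inl ⟨rfl, rfl⟩)) h (k := 8) (l := 8) (by norm_num)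
    (by norm_num)]
  norm_num [sideImages, Set.image_insert_eq, sortPair]

theorem encard_neighborSet_five (h : ((5, 5) : ℤ × ℤ) ∈ sidePairs 5) :
    ((sideGraph 5).neighborSet ⟨(5, 5), h⟩).encard = 2 := by
  rw [encard_neighborSet_sideGraph (.inr (.inr ⟨rfl, rfl⟩)) h (k := 20) (l := 5) (by norm_num)
    (by norm_num)]
  have himage : sortPair '' sideImages 5 5 20 5 = {(5, 85), (5, 10)} := by
    norm_num [sideImages, Set.image_insert_eq, sortPair]
  rw [himage]
  exact Set.encard_pair (by norm_num)

end SideGraph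

/-! ## Solutions of the Markov–Rosenberger equation -/

section Solutions

variable {f s : ℤ} {x y : ℤ × ℤ × ℤ}

theorem mapsTo_phi₁ (hf : 0 < f) : Set.MapsTo (phi₁ f s) (solutions f s) (solutions f s) := by
  rintro ⟨m, n, q⟩ ⟨hm, hn, hq, h⟩
  have hmul : m * (f * s * n * q - m) = n ^ 2 + f * q ^ 2 := by linear_combination -h
  refine ⟨pos_of_mul_pos_right (hmul ▸ by positivity) hm.le, hn, hq, ?_⟩
  simp only [phi₁]
  linear_combination h

theorem mapsTo_phi₂ (hf : 0 < f) : Set.MapsTo (phi₂ f s) (solutions f s) (solutions f s) := by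
  rintro ⟨m, n, q⟩ ⟨hm, hn, hq, h⟩
  have hmul : n * (f * s * m * q - n) = m ^ 2 + f * q ^ 2 := by linear_combination -h
  refine ⟨hm, pos_of_mul_pos_right (hmul ▸ by positivity) hn.le, hq, ?_⟩
  simp only [phi₂]
  linear_combination h

theorem mapsTo_phi₃ (hf : 0 < f) : Set.MapsTo (phi₃ s) (solutions f s) (solutions f s) := by
  rintro ⟨m, n, q⟩ ⟨hm, hn, hq, h⟩
  have hmul : f * q * (s * m * n - q) = m ^ 2 + n ^ 2 := by linear_combination -h
  refine ⟨hm, hn, (mul_pos_iff_of_pos_left (mul_pos hf hq)).1 (hmul ▸ by positivity), ?_⟩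
  simp only [phi₃]
  linear_combination h

theorem phi₁_phi₁ (f s : ℤ) (x : ℤ × ℤ × ℤ) : phi₁ f s (phi₁ f s x) = x := by
  simp only [phi₁, sub_sub_cancel]

theorem phi₂_phi₂ (f s : ℤ) (x : ℤ × ℤ × ℤ) : phi₂ f s (phi₂ f s x) = x := by
  simp only [phi₂, sub_sub_cancel]

theorem phi₃_phi₃ (s : ℤ) (x : ℤ × ℤ × ℤ) : phi₃ s (phi₃ s x) = x := by
  simp only [phi₃, sub_sub_cancel]

/-- The relation between two triples, one of which is the image of the other under one of
`φ₁, φ₂, φ₃`. -/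
def SolutionStep (f s : ℤ) (x y : ℤ × ℤ × ℤ) : Prop :=
  y = phi₁ f s x ∨ y = phi₂ f s x ∨ y = phi₃ s x

theorem SolutionStep.symm (h : SolutionStep f s x y) : SolutionStep f s y x := by
  rcases h with rfl | rfl | rfl
  exacts [.inl (phi₁_phi₁ f s x).symm, .inr (.inl (phi₂_phi₂ f s x).symm),
    .inr (.inr (phi₃_phi₃ s x).symm)]

theorem SolutionStep.mem_solutions (hf : 0 < f) (h : SolutionStep f s x y)
    (hx : x ∈ solutions f s) : y ∈ solutions f s := by
  rcases h with rfl | rfl | rfl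
  exacts [mapsTo_phi₁ hf hx, mapsTo_phi₂ hf hx, mapsTo_phi₃ hf hx]

theorem solutionGraph_adj_iff {x y : solutions f s} :
    (solutionGraph f s).Adj x y ↔ x ≠ y ∧ SolutionStep f s x.1 y.1 := by
  rw [solutionGraph, SimpleGraph.fromRel_adj]
  exact and_congr_right fun _ => or_iff_left_of_imp SolutionStep.symm

theorem SolutionStep.eq_of_sum_eq (h : SolutionStep f s x y)
    (hsum : x.1 + x.2.1 + x.2.2 = y.1 + y.2.1 + y.2.2) : x = y := by
  rcases h with rfl | rfl | rfl <;> ext <;> simp only [phi₁, phi₂, phi₃] at hsum ⊢ <;> linarith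

theorem phi₁_fst_lt_iff (hx : x ∈ solutions f s) :
    (phi₁ f s x).1 < x.1 ↔ x.2.1 ^ 2 + f * x.2.2 ^ 2 < x.1 ^ 2 := by
  obtain ⟨hm, -, -, h⟩ := hx
  rw [← mul_lt_mul_iff_right₀ hm, phi₁]
  constructor <;> intro hlt <;> linarith

theorem phi₂_snd_lt_iff (hx : x ∈ solutions f s) :
    (phi₂ f s x).2.1 < x.2.1 ↔ x.1 ^ 2 + f * x.2.2 ^ 2 < x.2.1 ^ 2 := by
  obtain ⟨-, hn, -, h⟩ := hx
  rw [← mul_lt_mul_iff_right₀ hn, phi₂]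
  constructor <;> intro hlt <;> linarith

theorem phi₃_thd_lt_iff (hf : 0 < f) (hx : x ∈ solutions f s) :
    (phi₃ s x).2.2 < x.2.2 ↔ x.1 ^ 2 + x.2.1 ^ 2 < f * x.2.2 ^ 2 := by
  obtain ⟨-, -, hq, h⟩ := hx
  rw [← mul_lt_mul_iff_right₀ (mul_pos hf hq), phi₃]
  constructor <;> intro hlt <;> linarith

/-- The height of a solution in the rooted forest of solutions: the sum of its entries. -/
def solutionHeight (x : solutions f s) : ℕ := (x.1.1 + x.1.2.1 + x.1.2.2).toNat

theorem solutionHeight_cast (x : solutions f s) :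
    (solutionHeight x : ℤ) = x.1.1 + x.1.2.1 + x.1.2.2 :=
  Int.toNat_of_nonneg (add_pos (add_pos x.2.1 x.2.2.1) x.2.2.2.1).le

theorem solutionHeight_lt_iff {x y : solutions f s} :
    solutionHeight x < solutionHeight y ↔
      x.1.1 + x.1.2.1 + x.1.2.2 < y.1.1 + y.1.2.1 + y.1.2.2 := by
  rw [← solutionHeight_cast, ← solutionHeight_cast, Nat.cast_lt]

theorem SolutionStep.lower_cases (hf : 0 < f) (h : SolutionStep f s x y) (hx : x ∈ solutions f s)
    (hlt : y.1 + y.2.1 + y.2.2 < x.1 + x.2.1 + x.2.2) :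
    (y = phi₁ f s x ∧ x.2.1 ^ 2 + f * x.2.2 ^ 2 < x.1 ^ 2) ∨
      (y = phi₂ f s x ∧ x.1 ^ 2 + f * x.2.2 ^ 2 < x.2.1 ^ 2) ∨
      (y = phi₃ s x ∧ x.1 ^ 2 + x.2.1 ^ 2 < f * x.2.2 ^ 2) := by
  rw [← phi₁_fst_lt_iff hx, ← phi₂_snd_lt_iff hx, ← phi₃_thd_lt_iff hf hx]
  refine h.imp ?_ (Or.imp ?_ ?_) <;> rintro rfl <;> refine ⟨rfl, ?_⟩ <;>
    simpa [phi₁, phi₂, phi₃] using hlt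

/-- At most one of `m²`, `n²`, `f q²` exceeds the sum of the other two. -/
theorem isRootedForest_solutionGraph (hf : 0 < f) :
    IsRootedForest (solutionGraph f s) solutionHeight where
  height_ne x y hadj heq := by
    obtain ⟨hne, hstep⟩ := solutionGraph_adj_iff.1 hadj
    refine hne (Subtype.ext (hstep.eq_of_sum_eq ?_))
    rw [← solutionHeight_cast, ← solutionHeight_cast, heq]
  lower_unique x y z hxy hxz hy hz := by
    have hm := pow_pos x.2.1 2
    have hn := pow_pos x.2.2.1 2
    have hq := mul_pos hf (pow_pos x.2.2.2.1 2)
    have hy := (solutionGraph_adj_iff.1 hxy).2.lower_cases hf x.2 (solutionHeight_lt_iff.1 hy)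
    have hz := (solutionGraph_adj_iff.1 hxz).2.lower_cases hf x.2 (solutionHeight_lt_iff.1 hz)
    rw [Subtype.ext_iff]
    rcases hy with ⟨hy, hlt⟩ | ⟨hy, hlt⟩ | ⟨hy, hlt⟩ <;>
      rcases hz with ⟨hz, hlt'⟩ | ⟨hz, hlt'⟩ | ⟨hz, hlt'⟩ <;>
      first | exact hy.trans hz.symm | linarith

theorem sq_le_of_isRoot (hf : 0 < f) {x : solutions f s}
    (hroot : IsRoot (solutionGraph f s) solutionHeight x) :
    x.1.1 ^ 2 ≤ x.1.2.1 ^ 2 + f * x.1.2.2 ^ 2 ∧ x.1.2.1 ^ 2 ≤ x.1.1 ^ 2 + f * x.1.2.2 ^ 2 ∧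
      f * x.1.2.2 ^ 2 ≤ x.1.1 ^ 2 + x.1.2.1 ^ 2 := by
  have not_lower {y : ℤ × ℤ × ℤ} (hstep : SolutionStep f s x.1 y) :
      x.1.1 + x.1.2.1 + x.1.2.2 ≤ y.1 + y.2.1 + y.2.2 := by
    by_contra! hlt
    let y' : solutions f s := ⟨y, hstep.mem_solutions hf x.2⟩
    refine (hroot y' (solutionGraph_adj_iff.2 ⟨?_, hstep⟩)).not_gt (solutionHeight_lt_iff.2 hlt)
    intro heq
    exact hlt.ne' (congrArg (fun z : solutions f s => z.1.1 + z.1.2.1 + z.1.2.2) heq)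
  simp only [← not_lt]
  rw [← phi₁_fst_lt_iff x.2, ← phi₂_snd_lt_iff x.2, ← phi₃_thd_lt_iff hf x.2]
  simp only [not_lt]
  refine ⟨?_, ?_, ?_⟩
  · simpa [phi₁] using not_lower (.inl rfl)
  · simpa [phi₂] using not_lower (.inr (.inl rfl))
  · simpa [phi₃] using not_lower (.inr (.inr rfl))

end Solutions

/-! ## The roots -/

/-- If `A` is the least of the three numbers and `K` their sum, then `4 B` and `4 C` are at least
`K`, whence `c A ≤ 16`. Moreover `0 ≤ (K - 2 B) (K - 2 C)` says that `K (c A - 4) ≤ 2 c A²`. -/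
theorem sum_le_ten_of_sq_eq_mul {A B C c : ℤ} (hc : 5 ≤ c) (hA : 0 < A) (hB : 0 < B) (hC : 0 < C)
    (hAK : A ≤ B + C) (hBK : B ≤ A + C) (hCK : C ≤ A + B)
    (h : (A + B + C) ^ 2 = c * A * B * C) : A + B + C ≤ 10 := by
  wlog hAB : A ≤ B generalizing A B C
  · rw [add_comm A B] at h ⊢
    exact this hB hA hC hBK hAK (by linarith) (by linarith) (by linarith)
  wlog hAC : A ≤ C generalizing A B C
  · have := this hC hB hA (by linarith) (by linarith) (by linarith) (by linarith) (by linarith)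
      (by linarith)
    linarith
  have hBC : (A + B + C) ^ 2 ≤ 16 * (B * C) := by
    have : (A + B + C) * (A + B + C) ≤ (4 * B) * (4 * C) := by gcongr <;> linarith
    linarith
  have hcA : c * A ≤ 16 :=
    le_of_mul_le_mul_right (by linarith : c * A * (B * C) ≤ 16 * (B * C)) (by positivity)
  have hK : (A + B + C) * (c * A - 4) ≤ 2 * (c * A) * A := by
    have hnonneg : 0 ≤ c * A * ((A + C - B) * (A + B - C)) :=
      mul_nonneg (by positivity) (mul_nonneg (by linarith) (by linarith))
    refine le_of_mul_le_mul_left ?_ (by positivity : 0 < A + B + C)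
    linear_combination hnonneg - 4 * h
  have hA3 : A ≤ 3 := by nlinarith
  by_contra! hlt
  interval_cases A <;> nlinarith

/-- The parameters `f` and `s` of the three equations, with the integer `r` for which `(1, r, 1)`
is a solution with minimal sum of entries. -/
def IsMarkovParameter (f s r : ℤ) : Prop :=
  (f = 1 ∧ s = 3 ∧ r = 1) ∨ (f = 2 ∧ s = 2 ∧ r = 1) ∨ (f = 5 ∧ s = 1 ∧ r = 2)

section Roots

variable {f s r : ℤ}

theorem IsMarkovParameter.f_pos (h : IsMarkovParameter f s r) : 0 < f := by
  rcases h with ⟨rfl, -⟩ | ⟨rfl, -⟩ | ⟨rfl, -⟩ <;> norm_num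

theorem IsMarkovParameter.s_pos (h : IsMarkovParameter f s r) : 0 < s := by
  rcases h with ⟨-, rfl, -⟩ | ⟨-, rfl, -⟩ | ⟨-, rfl, -⟩ <;> norm_num

theorem IsMarkovParameter.mem_solutions (h : IsMarkovParameter f s r) :
    (1, r, 1) ∈ solutions f s := by
  rcases h with ⟨rfl, rfl, rfl⟩ | ⟨rfl, rfl, rfl⟩ | ⟨rfl, rfl, rfl⟩ <;> simp [solutions]

theorem IsMarkovParameter.eq_of_sq_le (h : IsMarkovParameter f s r) {m n q : ℤ}
    (hx : (m, n, q) ∈ solutions f s) (hm : m ^ 2 ≤ n ^ 2 + f * q ^ 2)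
    (hn : n ^ 2 ≤ m ^ 2 + f * q ^ 2) (hq : f * q ^ 2 ≤ m ^ 2 + n ^ 2) :
    (m, n, q) = (1, r, 1) ∨ (m, n, q) = (r, 1, 1) := by
  obtain ⟨hm0, hn0, hq0, heq⟩ := hx
  simp only at hm0 hn0 hq0 heq
  have hf := h.f_pos
  have hfs : 5 ≤ f * s ^ 2 := by
    rcases h with ⟨rfl, rfl, -⟩ | ⟨rfl, rfl, -⟩ | ⟨rfl, rfl, -⟩ <;> norm_num
  have hsum : m ^ 2 + n ^ 2 + f * q ^ 2 ≤ 10 :=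
    sum_le_ten_of_sq_eq_mul hfs (by positivity) (by positivity) (by positivity) hm hn hq
      (by rw [heq]; ring)
  have hq1 := le_mul_of_one_le_left (sq_nonneg q) (show 1 ≤ f from hf)
  have hm3 : m ≤ 3 := by nlinarith
  have hn3 : n ≤ 3 := by nlinarith
  have hq3 : q ≤ 3 := by nlinarith
  simp only [Prod.mk.injEq]
  rcases h with ⟨rfl, rfl, rfl⟩ | ⟨rfl, rfl, rfl⟩ | ⟨rfl, rfl, rfl⟩ <;>
    interval_cases m <;> interval_cases n <;> interval_cases q <;> lia

/-- The solution `(1, r, 1)`. -/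
def IsMarkovParameter.root (h : IsMarkovParameter f s r) : solutions f s := ⟨_, h.mem_solutions⟩

theorem IsMarkovParameter.eq_root_or_eq_swap_root (h : IsMarkovParameter f s r)
    {x : solutions f s} (hx : IsRoot (solutionGraph f s) solutionHeight x) :
    x = h.root ∨ x = swap h.root := by
  obtain ⟨hm, hn, hq⟩ := sq_le_of_isRoot h.f_pos hx
  exact (h.eq_of_sq_le x.2 hm hn hq).imp Subtype.ext Subtype.ext

theorem swap_swap (x : solutions f s) : swap (swap x) = x := rfl

theorem SolutionStep.swap {x y : solutions f s} (h : SolutionStep f s x.1 y.1) :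
    SolutionStep f s (swap x).1 (swap y).1 := by
  simp only [SolutionStep, LEP.swap]
  rcases h with h | h | h <;> rw [h]
  exacts [.inr (.inl rfl), .inl rfl, .inr (.inr (by simp only [phi₃, mul_right_comm s]))]

/-- The swap as an automorphism of the graph of solutions. -/
def swapIso (f s : ℤ) : solutionGraph f s ≃g solutionGraph f s where
  toEquiv := Function.Involutive.toPerm swap swap_swap
  map_rel_iff' := by
    intro x y
    rw [solutionGraph_adj_iff, solutionGraph_adj_iff]
    exact and_congr (Equiv.apply_eq_iff_eq _).not ⟨SolutionStep.swap, SolutionStep.swap⟩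

theorem solutionGraph_isTree (h : IsMarkovParameter f s 1) : (solutionGraph f s).IsTree :=
  (isRootedForest_solutionGraph h.f_pos).isTree (r := h.root) fun _ hx =>
    (h.eq_root_or_eq_swap_root hx).elim id id

theorem solutionHeight_swap (x : solutions f s) : solutionHeight (swap x) = solutionHeight x := by
  simp only [solutionHeight, swap, add_comm x.1.1]

theorem reachable_solutionGraph_iff (h : IsMarkovParameter f s r) (hr : r ≠ 1)
    (x y : solutions f s) :
    (solutionGraph f s).Reachable x y ↔ ¬ (solutionGraph f s).Reachable x (swap y) :=
  (isRootedForest_solutionGraph h.f_pos).reachable_iff_not_reachable_of_two_roots (r := h.root)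
    (swapIso f s) swap_swap solutionHeight_swap
    (fun heq => hr (congrArg (fun x : solutions f s => x.1.1) heq))
    (fun _ hx => h.eq_root_or_eq_swap_root hx) x y

/-! ## Quotients -/

theorem quotGraph_eq_map {V : Type*} (G : SimpleGraph V) (r : V → V → Prop) :
    quotGraph G r = G.map (Quot.mk r) := by
  ext A B
  rw [SimpleGraph.map_adj']
  exact and_congr_right fun _ => exists₂_congr fun x y => by tauto

theorem mk_swapRel_eq_iff {x y : solutions f s} :
    Quot.mk (swapRel f s) x = Quot.mk (swapRel f s) y ↔ y = x ∨ y = swap x := by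
  constructor
  · intro h
    have horbit : ({x, swap x} : Set (solutions f s)) = {y, swap y} :=
      congrArg (Quot.lift (fun z => ({z, swap z} : Set (solutions f s)))
        (by rintro z _ rfl; exact Set.pair_comm z (swap z))) h
    exact horbit.ge (Set.mem_insert y {swap y})
  · rintro (rfl | rfl)
    exacts [rfl, Quot.sound rfl]

/-- The sum of the entries of a solution, which is the same for its swap. -/
def swapHeight (A : Quot (swapRel f s)) : ℕ :=
  Quot.lift solutionHeight (by rintro x _ rfl; exact (solutionHeight_swap x).symm) A

theorem swapQuotient_isTree (h : IsMarkovParameter f s r) : (swapQuotient f s).IsTree := by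
  have hforest : IsRootedForest (solutionGraph f s) (swapHeight ∘ Quot.mk (swapRel f s)) :=
    isRootedForest_solutionGraph h.f_pos
  rw [swapQuotient, quotGraph_eq_map]
  refine (hforest.map (Quot.mk _) fun x y hxy => ?_).isTree (r := Quot.mk _ h.root) ?_
  · rcases mk_swapRel_eq_iff.1 hxy with rfl | rfl
    · exact ⟨.refl, rfl, fun _ => rfl⟩
    · exact ⟨swapIso f s, rfl, fun v => mk_swapRel_eq_iff.2 (.inr rfl)⟩
  · rintro ⟨x⟩ hx
    exact (mk_swapRel_eq_iff.2 (h.eq_root_or_eq_swap_root (hforest.isRoot_of_map hx))).symm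

end Roots

/-! ## From solutions to side pairs -/

section SidesOf

variable {f s : ℤ} {x y : ℤ × ℤ × ℤ}

theorem exchange_sidesOf_iff {m n q b' : ℤ} (hx : (m, n, q) ∈ solutions f s) :
    Exchange (f * s * q) (f * s * (s * m * n - q)) b' ↔
      b' = f * s * (s * (f * s * n * q - m) * n - q) ∨
        b' = f * s * (s * m * (f * s * m * q - n) - q) := by
  obtain ⟨-, -, -, heq⟩ := hx
  rw [exchange_iff (k := f * s ^ 2 * n ^ 2) (l := f * s ^ 2 * m ^ 2)
    (by linear_combination f * s ^ 2 * heq) (by ring)]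
  ring_nf

theorem sidesOf_phi₃ (f s : ℤ) (x : ℤ × ℤ × ℤ) : sidesOf f s (phi₃ s x) = sidesOf f s x := by
  simp only [sidesOf, phi₃, sub_sub_cancel]
  exact sortPair_mk_comm _ _

theorem sidesOf_swap (x : solutions f s) : sidesOf f s (swap x).1 = sidesOf f s x.1 := by
  simp only [sidesOf, swap, mul_right_comm s]

/-- Exchanging the side `f s (s m n - q)` amounts to `φ₁` or `φ₂`, and exchanging the side `f s q`
to `φ₁` or `φ₂` after `φ₃`. -/
theorem sideStep_sidesOf_iff (hf : 0 < f) (hx : x ∈ solutions f s) {p : ℤ × ℤ} :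
    SideStep (sidesOf f s x) p ↔
      (p = sidesOf f s (phi₁ f s x) ∨ p = sidesOf f s (phi₂ f s x)) ∨
        p = sidesOf f s (phi₁ f s (phi₃ s x)) ∨ p = sidesOf f s (phi₂ f s (phi₃ s x)) := by
  have hx₃ := mapsTo_phi₃ hf hx
  have hexchange₃ (b' : ℤ) := exchange_sidesOf_iff (b' := b') hx₃
  simp only [sub_sub_cancel] at hexchange₃
  rw [sidesOf, sideStep_sortPair_iff]
  simp only [exchange_sidesOf_iff hx, hexchange₃, or_and_right, exists_or, exists_eq_left]
  rfl

theorem SolutionStep.sideStep_or_eq (hf : 0 < f) (h : SolutionStep f s x y)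
    (hx : x ∈ solutions f s) :
    SideStep (sidesOf f s x) (sidesOf f s y) ∨ sidesOf f s y = sidesOf f s x := by
  rcases h with rfl | rfl | rfl
  exacts [.inl ((sideStep_sidesOf_iff hf hx).2 (.inl (.inl rfl))),
    .inl ((sideStep_sidesOf_iff hf hx).2 (.inl (.inr rfl))), .inr (sidesOf_phi₃ f s x)]

theorem exists_solutionStep_of_sideStep (hf : 0 < f) (x : solutions f s) {p : ℤ × ℤ}
    (h : SideStep (sidesOf f s x.1) p) :
    ∃ y z : solutions f s, sidesOf f s y.1 = sidesOf f s x.1 ∧ sidesOf f s z.1 = p ∧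
      SolutionStep f s y.1 z.1 := by
  have hx₃ := mapsTo_phi₃ hf x.2
  rcases (sideStep_sidesOf_iff hf x.2).1 h with (rfl | rfl) | rfl | rfl
  · exact ⟨x, ⟨_, mapsTo_phi₁ hf x.2⟩, rfl, rfl, .inl rfl⟩
  · exact ⟨x, ⟨_, mapsTo_phi₂ hf x.2⟩, rfl, rfl, .inr (.inl rfl)⟩
  · exact ⟨⟨_, hx₃⟩, ⟨_, mapsTo_phi₁ hf hx₃⟩, sidesOf_phi₃ f s x, rfl, .inl rfl⟩
  · exact ⟨⟨_, hx₃⟩, ⟨_, mapsTo_phi₂ hf hx₃⟩, sidesOf_phi₃ f s x, rfl, .inr (.inl rfl)⟩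

theorem eq_or_eq_swap_of_mul_eq (hs : s ≠ 0) {x y : solutions f s} (hq : x.1.2.2 = y.1.2.2)
    (hmul : s * x.1.1 * x.1.2.1 = s * y.1.1 * y.1.2.1) : y = x ∨ y = swap x := by
  obtain ⟨⟨m, n, q⟩, hm, hn, _, hx⟩ := x
  obtain ⟨⟨m', n', q'⟩, hm', hn', _, hy⟩ := y
  obtain rfl : q = q' := hq
  simp only at hm hn hm' hn' hx hy hmul
  have hmn : m * n = m' * n' := mul_left_cancel₀ hs (by linarith)
  have hadd : m + n = m' + n' := by
    refine (pow_left_inj₀ (by positivity) (by positivity) two_ne_zero).1 ?_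
    linear_combination hx - hy + 2 * hmn + f * q * hmul
  have hfactor : (m' - m) * (m' - n) = 0 := by linear_combination hmn - m' * hadd
  simp only [Subtype.ext_iff, swap, Prod.mk.injEq, and_true]
  rcases mul_eq_zero.1 hfactor with h | h
  · exact .inl ⟨by linarith, by linarith⟩
  · exact .inr ⟨by linarith, by linarith⟩

theorem mk_mk_eq_iff (hf : 0 < f) (hs : s ≠ 0) {x y : solutions f s} :
    Quot.mk (phi₃Rel f s) (Quot.mk (swapRel f s) x) = Quot.mk _ (Quot.mk _ y) ↔
      sidesOf f s x.1 = sidesOf f s y.1 := by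
  have hmk {x y : solutions f s} (hq : x.1.2.2 = y.1.2.2)
      (hmul : s * x.1.1 * x.1.2.1 = s * y.1.1 * y.1.2.1) :
      Quot.mk (phi₃Rel f s) (Quot.mk (swapRel f s) x) = Quot.mk _ (Quot.mk _ y) :=
    congrArg _ (mk_swapRel_eq_iff.2 (eq_or_eq_swap_of_mul_eq hs hq hmul))
  constructor
  · refine congrArg (Quot.lift (Quot.lift (fun z : solutions f s => sidesOf f s z.1) ?_) ?_)
    · rintro z _ rfl
      exact (sidesOf_swap z).symm
    · rintro _ _ ⟨z, z', rfl, rfl, hz⟩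
      exact (hz ▸ sidesOf_phi₃ f s z.1).symm
  · rw [sidesOf, sidesOf, sortPair_mk_eq_iff]
    have hfs : f * s ≠ 0 := mul_ne_zero hf.ne' hs
    simp only [mul_right_inj' hfs]
    rintro (⟨hq, hq'⟩ | ⟨hq, hq'⟩)
    · exact hmk hq (by linarith)
    · let x₃ : solutions f s := ⟨phi₃ s x.1, mapsTo_phi₃ hf x.2⟩
      exact (Quot.sound ⟨x, x₃, rfl, rfl, rfl⟩).trans (hmk hq' (by simp only [x₃, phi₃]; linarith))

end SidesOf

theorem exists_iso_map_of_eq_iff {V W U : Type*} (G : SimpleGraph V) {π : V → W} {c : V → U}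
    (hπ : Function.Surjective π) (hc : Function.Surjective c)
    (h : ∀ x y, π x = π y ↔ c x = c y) : ∃ e : G.map π ≃g G.map c, ∀ x, e (π x) = c x := by
  have hsurj (x : V) : c (Function.surjInv hπ (π x)) = c x :=
    (h _ _).1 (Function.surjInv_eq hπ _)
  let e : W ≃ U := Equiv.ofBijective (c ∘ Function.surjInv hπ)
    ⟨fun A B hAB => by simpa only [Function.surjInv_eq] using (h _ _).2 hAB,
      fun u => (hc u).elim fun x hx => ⟨π x, (hsurj x).trans hx⟩⟩
  have he (x : V) : e (π x) = c x := hsurj x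
  refine ⟨⟨e, ?_⟩, he⟩
  intro A B
  simp only [SimpleGraph.map_adj', e.injective.ne_iff, ← he, e.apply_eq_iff_eq]

section Sides

variable {g : ℕ} {f s r : ℤ}

theorem IsMarkovParameter.isRootPair (h : IsMarkovParameter f s r) (hg : (g : ℤ) = f * s) :
    IsRootPair g (sidesOf f s (1, r, 1)) := by
  rcases h with ⟨rfl, rfl, rfl⟩ | ⟨rfl, rfl, rfl⟩ | ⟨rfl, rfl, rfl⟩
  · exact .inl ⟨by lia, rfl⟩
  · exact .inr (.inl ⟨by lia, rfl⟩)
  · exact .inr (.inr ⟨by lia, rfl⟩)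

theorem IsMarkovParameter.sidesOf_mem_sidePairs (h : IsMarkovParameter f s r)
    (hg : (g : ℤ) = f * s) (x : solutions f s) : sidesOf f s x.1 ∈ sidePairs g := by
  induction x using descent_induction (G := solutionGraph f s) (h := solutionHeight) with
  | root x hx =>
    have hroot := (h.isRootPair hg).mem_sidePairs
    rcases h.eq_root_or_eq_swap_root hx with rfl | rfl
    exacts [hroot, (sidesOf_swap h.root).symm ▸ hroot]
  | step x y hxy _ ih =>
    rcases (solutionGraph_adj_iff.1 hxy).2.sideStep_or_eq h.f_pos x.2 with hstep | heq
    exacts [hstep.symm.mem_sidePairs ih, heq ▸ ih]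

/-- The side pair attached to a solution, as a vertex of the graph of side pairs. -/
def IsMarkovParameter.sides (h : IsMarkovParameter f s r) (hg : (g : ℤ) = f * s)
    (x : solutions f s) : sidePairs g := ⟨_, h.sidesOf_mem_sidePairs hg x⟩

theorem IsMarkovParameter.sides_surjective (h : IsMarkovParameter f s r) (hg : (g : ℤ) = f * s) :
    Function.Surjective (h.sides hg) := by
  have hρ := h.isRootPair hg
  intro p
  induction p using descent_induction (G := sideGraph g) (h := sideHeight) with
  | root p hp => exact ⟨h.root, (eq_root_of_isRoot hρ p hp).symm⟩
  | step p p' hadj _ ih =>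
    obtain ⟨x, rfl⟩ := ih
    obtain ⟨-, z, -, hz, -⟩ := exists_solutionStep_of_sideStep h.f_pos x
      ((sideGraph_adj_iff hρ).1 hadj).symm
    exact ⟨z, Subtype.ext hz⟩

theorem IsMarkovParameter.sideGraph_eq_map (h : IsMarkovParameter f s r)
    (hg : (g : ℤ) = f * s) : sideGraph g = (solutionGraph f s).map (h.sides hg) := by
  have hρ := h.isRootPair hg
  ext p p'
  constructor
  · intro hadj
    obtain ⟨x, rfl⟩ := h.sides_surjective hg p
    obtain ⟨y, z, hy, hz, hstep⟩ :=
      exists_solutionStep_of_sideStep h.f_pos x ((sideGraph_adj_iff hρ).1 hadj)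
    obtain rfl : h.sides hg z = p' := Subtype.ext hz
    have hy : h.sides hg y = h.sides hg x := Subtype.ext hy
    refine ⟨hadj.ne, y, z, solutionGraph_adj_iff.2 ⟨?_, hstep⟩, hy, rfl⟩
    rintro rfl
    exact hadj.ne hy.symm
  · rintro ⟨hne, x, y, hadj, rfl, rfl⟩
    rw [sideGraph_adj_iff hρ]
    exact ((solutionGraph_adj_iff.1 hadj).2.sideStep_or_eq h.f_pos x.2).resolve_right
      fun heq => hne (Subtype.ext heq.symm)

theorem IsMarkovParameter.exists_contractedGraph_iso (h : IsMarkovParameter f s r)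
    (hg : (g : ℤ) = f * s) : ∃ e : contractedGraph f s ≃g sideGraph g,
      ∀ x : solutions f s, (e (Quot.mk _ (Quot.mk _ x))).1 = sidesOf f s x.1 := by
  obtain ⟨e, he⟩ := exists_iso_map_of_eq_iff (solutionGraph f s)
    (π := Quot.mk (phi₃Rel f s) ∘ Quot.mk (swapRel f s)) (c := h.sides hg)
    (Quot.mk_surjective.comp Quot.mk_surjective) (h.sides_surjective hg)
    fun x y => (mk_mk_eq_iff h.f_pos h.s_pos.ne').trans
      ⟨fun heq => Subtype.ext heq, congrArg Subtype.val⟩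
  have hmap : contractedGraph f s = (solutionGraph f s).map
      (Quot.mk (phi₃Rel f s) ∘ Quot.mk (swapRel f s)) := by
    rw [contractedGraph, swapQuotient, quotGraph_eq_map, quotGraph_eq_map, SimpleGraph.map_map]
  rw [hmap, h.sideGraph_eq_map hg]
  exact ⟨e, fun x => congrArg Subtype.val (he x)⟩

end Sides

end LEP

theorem mainTheorem4 (g : ℕ) (f s : ℤ) (root : ℤ × ℤ) (d : ℕ∞)
    (h : (g = 3 ∧ f = 1 ∧ s = 3 ∧ root = (3, 6) ∧ d = 2) ∨
      (g = 4 ∧ f = 2 ∧ s = 2 ∧ root = (4, 4) ∧ d = 1) ∨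
      (g = 5 ∧ f = 5 ∧ s = 1 ∧ root = (5, 5) ∧ d = 2)) :
    -- `T_g` is an infinite tree
    Infinite (LEP.sidePairs g) ∧
    (LEP.sideGraph g).IsTree ∧
    -- the four maps act on `T_g`, and the neighbours of a vertex are its images
    (∀ p ∈ LEP.sidePairs g, ∀ F ∈ LEP.sideMaps,
      ∃ p' ∈ LEP.sidePairs g, LEP.sortPair (F (LEP.toReal p)) = LEP.toReal p') ∧
    (∀ p p' : LEP.sidePairs g, (LEP.sideGraph g).Adj p p' ↔
      ∃ F ∈ LEP.sideMaps, LEP.sortPair (F (LEP.toReal p.1)) = LEP.toReal p'.1) ∧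
    -- the solution graph
    Set.MapsTo (LEP.phi₁ f s) (LEP.solutions f s) (LEP.solutions f s) ∧
    Set.MapsTo (LEP.phi₂ f s) (LEP.solutions f s) (LEP.solutions f s) ∧
    Set.MapsTo (LEP.phi₃ s) (LEP.solutions f s) (LEP.solutions f s) ∧
    (g ≠ 5 → (LEP.solutionGraph f s).IsTree) ∧
    (g = 5 → (LEP.solutionGraph f s).IsAcyclic ∧
      ∀ x y : LEP.solutions f s, (LEP.solutionGraph f s).Reachable x y ↔
        ¬ (LEP.solutionGraph f s).Reachable x (LEP.swap y)) ∧
    -- its quotient by the swap is a tree, and contracting the `φ₃`-edges there yields `T_g`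
    (LEP.swapQuotient f s).IsTree ∧
    (∃ e : LEP.contractedGraph f s ≃g LEP.sideGraph g,
      ∀ x : LEP.solutions f s, (e (Quot.mk _ (Quot.mk _ x))).1 = LEP.sidesOf f s x.1) ∧
    -- the root, the vertex with the least sum of entries, and the degrees
    (∀ p ∈ LEP.sidePairs g, p ≠ root → root.1 + root.2 < p.1 + p.2) ∧
    (∃ hr : root ∈ LEP.sidePairs g, ((LEP.sideGraph g).neighborSet ⟨root, hr⟩).encard = d) ∧
    (∀ p : LEP.sidePairs g, p.1 ≠ root → ((LEP.sideGraph g).neighborSet p).encard = 4) := by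
  have hρ : LEP.IsRootPair g root := by grind [LEP.IsRootPair]
  obtain ⟨r, hfs, hg, hr⟩ :
      ∃ r, LEP.IsMarkovParameter f s r ∧ (g : ℤ) = f * s ∧ (g = 5 ↔ r ≠ 1) := by
    rcases h with ⟨rfl, rfl, rfl, -⟩ | ⟨rfl, rfl, rfl, -⟩ | ⟨rfl, rfl, rfl, -⟩
    exacts [⟨1, by simp [LEP.IsMarkovParameter]⟩, ⟨1, by simp [LEP.IsMarkovParameter]⟩,
      ⟨2, by simp [LEP.IsMarkovParameter]⟩]
  refine ⟨LEP.infinite_sidePairs ⟨_, hρ.mem_sidePairs⟩, LEP.sideGraph_isTree hρ, ?maps,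
    fun p p' => by rw [LEP.sideGraph_adj_iff hρ, LEP.exists_mem_sideMaps_iff p.2],
    LEP.mapsTo_phi₁ hfs.f_pos, LEP.mapsTo_phi₂ hfs.f_pos, LEP.mapsTo_phi₃ hfs.f_pos, ?tree,
    fun h5 => ⟨(LEP.isRootedForest_solutionGraph hfs.f_pos).isAcyclic,
      LEP.reachable_solutionGraph_iff hfs (hr.1 h5)⟩,
    LEP.swapQuotient_isTree hfs, hfs.exists_contractedGraph_iso hg,
    fun _ => LEP.root_sum_lt hρ, ⟨hρ.mem_sidePairs, ?degree⟩, LEP.encard_neighborSet_of_ne_root hρ⟩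
  case maps =>
    intro p hp F hF
    obtain ⟨p', hstep, hF'⟩ := LEP.exists_sideStep_of_mem_sideMaps hp hF
    exact ⟨p', hstep.mem_sidePairs hp, hF'⟩
  case tree =>
    intro h5
    obtain rfl : r = 1 := not_ne_iff.1 (mt hr.2 h5)
    exact LEP.solutionGraph_isTree hfs
  case degree =>
    rcases h with ⟨rfl, -, -, rfl, rfl⟩ | ⟨rfl, -, -, rfl, rfl⟩ | ⟨rfl, -, -, rfl, rfl⟩
    exacts [LEP.encard_neighborSet_three _, LEP.encard_neighborSet_four _,
      LEP.encard_neighborSet_five _]
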